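/- Let $N\ge 1$. For $\gamma\in\mathbb R$ let $d\nu_\gamma(x,y)=|x-y|^{\gamma-N}\,dx\,dy$ on $\{(x,y)\in\mathbb R^N\times\mathbb R^N: x\ne y\}$. For measurable $u:\mathbb R^N\to\mathbb R$ and $\lambda>0$ put $$E_{\lambda,\gamma}[u]=\Big\{(x,y)\in\mathbb R^N\times\mathbb R^N:\ x\neq y,\ \frac{|u(x)-u(y)|}{|x-y|^{1+\gamma}}>\lambda\Big\}.$$ Let $\kappa(1,N)=\int_{\mathbb S^{N-1}}|e\cdot\omega|\,d\omega$, where $e$ is any unit vector of $\mathbb R^N$ (for $N=1$, $d\omega$ is counting measure on $\{\pm1\}$). For $u\in L^1_{\rm loc}(\mathbb R^N)$ let $$\|\nabla u\|_{\mathcal M}=\sup\Big\{\Big|\int_{\mathbb R^N}u\,\mathrm{div}\,\phi\,dx\Big|:\ \phi\in C^1_c(\mathbb R^N,\mathbb R^N),\ \|\phi\|_\infty\le1\Big\},$$ and let $\dot{BV}(\mathbb R^N)$ be the set of $u\in L^1_{\rm loc}(\mathbb R^N)$ with $\|\nabla u\|_{\mathcal M}<\infty$. (i) For every $\gamma>0$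 there is $u\in\dot{BV}(\mathbb R^N)$ for which $$\lim_{\lambda\to\infty}\lambda\,\nu_\gamma(E_{\lambda,\gamma}[u])=\frac{\kappa(1,N)}{|\gamma|}\|\nabla u\|_{\mathcal M}$$ fails (the limit does not exist in $[0,\infty]$, or it has a different value). For every $\gamma<0$ there is $u\in\dot{BV}(\mathbb R^N)$ for which $$\lim_{\lambda\to0^+}\lambda\,\nu_\gamma(E_{\lambda,\gamma}[u])=\frac{\kappa(1,N)}{|\gamma|}\|\nabla u\|_{\mathcal M}$$ fails in the same sense. (ii) Let $\Omega\subset\mathbb R^N$ be a bounded domain (nonempty, open and connected) with $C^\infty$ boundary and let $u=\mathbf 1_\Omega$. Then $u\in\dot{BV}(\mathbb R^N)$, $$\lim_{\lambda\to\infty}\lambda\,\nu_\gamma(E_{\lambda,\gamma}[u])=\frac{\kappa(1,N)}{|\gamma+1|}\|\nabla u\|_{\mathcal M}\quad\text{for all }\gamma>-1,$$ $$\lim_{\lambda\to0^+}\lambda\,\nu_\gamma(E_{\lambda,\gamma}[u])=\frac{\kappa(1,N)}{|\gamma+1|}\|\nabla u\|_{\mathcal M}\quad\text{for all }\gamma<-1.$$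 Moreover, for $\gamma\in\mathbb R\setminus\{-1,0\}$, one has $\frac{\kappa(1,N)}{|\gamma+1|}\|\nabla u\|_{\mathcal M}=\frac{\kappa(1,N)}{|\gamma|}\|\nabla u\|_{\mathcal M}$ if and only if $\gamma=-\frac12$. In particular, the limits as $\lambda\to\infty$ for $\gamma>0$ and as $\lambda\to0^+$ for $\gamma<-1$ exist but differ from $\frac{\kappa(1,N)}{|\gamma|}\|\nabla u\|_{\mathcal M}$. -/

import Mathlib

open Set Filter Topology MeasureTheory
open scoped ENNReal

noncomputable section

/-- The measure `ν_γ` on `ℝ^N × ℝ^N` with density `|x - y|^(γ - N)` off the diagonal. -/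
def nuMeasure (N : ℕ) (γ : ℝ) :
    Measure (EuclideanSpace ℝ (Fin N) × EuclideanSpace ℝ (Fin N)) :=
  (volume.restrict {z | z.1 ≠ z.2}).withDensity
    fun z => ENNReal.ofReal (‖z.1 - z.2‖ ^ (γ - (N : ℝ)))

/-- The difference quotient `Q_b u (x, y) = (u x - u y) / |x - y|^(1 + b)`. -/
def diffQuot {N : ℕ} (b : ℝ) (u : EuclideanSpace ℝ (Fin N) → ℝ)
    (x y : EuclideanSpace ℝ (Fin N)) : ℝ :=
  (u x - u y) / ‖x - y‖ ^ (1 + b)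

/-- The superlevel set `E_{t,b}[u] = {(x, y) : x ≠ y, |Q_b u (x, y)| > t}`. -/
def superlevelSet {N : ℕ} (t b : ℝ) (u : EuclideanSpace ℝ (Fin N) → ℝ) :
    Set (EuclideanSpace ℝ (Fin N) × EuclideanSpace ℝ (Fin N)) :=
  {z | z.1 ≠ z.2 ∧ t < |diffQuot b u z.1 z.2|}

/-- The constant `κ(p, N) = ∫_{S^{N-1}} |e · θ|^p dθ` (surface measure), where `e` is a unit
vector of `ℝ^N`; the value is the same for every unit vector `e`. -/
def kappa {N : ℕ} (p : ℝ) (e : EuclideanSpace ℝ (Fin N)) : ℝ :=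
  ∫ θ : Metric.sphere (0 : EuclideanSpace ℝ (Fin N)) 1,
    |inner ℝ e (θ : EuclideanSpace ℝ (Fin N))| ^ p
      ∂((volume : Measure (EuclideanSpace ℝ (Fin N))).toSphere)

/-- The divergence of a vector field on `ℝ^N`. -/
def divergence {N : ℕ} (φ : EuclideanSpace ℝ (Fin N) → EuclideanSpace ℝ (Fin N))
    (x : EuclideanSpace ℝ (Fin N)) : ℝ :=
  ∑ i, (fderiv ℝ φ x (EuclideanSpace.single i 1)) i

/-- The total variation `‖∇u‖_ℳ ∈ [0, ∞]` of the distributional gradient of `u`: the supremum of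
`|∫ u div φ|` over `C¹` compactly supported vector fields `φ` with `|φ| ≤ 1` everywhere. -/
def gradVariation {N : ℕ} (u : EuclideanSpace ℝ (Fin N) → ℝ) : ℝ≥0∞ :=
  ⨆ (φ : EuclideanSpace ℝ (Fin N) → EuclideanSpace ℝ (Fin N))
    (_ : ContDiff ℝ 1 φ ∧ HasCompactSupport φ ∧ ∀ x, ‖φ x‖ ≤ 1),
    ENNReal.ofReal |∫ x, u x * divergence φ x|

/-- The homogeneous space of functions of bounded variation on `ℝ^N`. -/
def MemBVDot {N : ℕ} (u : EuclideanSpace ℝ (Fin N) → ℝ) : Prop :=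
  LocallyIntegrable u ∧ gradVariation u < ⊤

/-- `Ω` has smooth boundary: near each boundary point it is the strict sublevel set `{ρ < 0}` of
a `C^∞` function `ρ` whose differential at that point is nonzero. -/
def HasSmoothBoundary {N : ℕ} (Ω : Set (EuclideanSpace ℝ (Fin N))) : Prop :=
  ∀ p ∈ frontier Ω, ∃ (U : Set (EuclideanSpace ℝ (Fin N))) (ρ : EuclideanSpace ℝ (Fin N) → ℝ),
    IsOpen U ∧ p ∈ U ∧ ContDiffOn ℝ ((⊤ : ℕ∞) : WithTop ℕ∞) ρ U ∧ fderiv ℝ ρ p ≠ 0 ∧ Ω ∩ U = {x ∈ U | ρ x < 0}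

/-- A bounded domain (nonempty connected open set) with smooth boundary. -/
structure IsBoundedSmoothDomain {N : ℕ} (Ω : Set (EuclideanSpace ℝ (Fin N))) : Prop where
  isOpen : IsOpen Ω
  isConnected : IsConnected Ω
  isBounded : Bornology.IsBounded Ω
  smoothBoundary : HasSmoothBoundary Ω

end

noncomputable section

open scoped Convolution

/-!
For `u = 1_Ω` the pair `(x + h, x)` lies in `E_{t,γ}[u]` exactly when `t |h|^(1 + γ) < 1` and only
one of the two points lies in `Ω`. Hence `ν_γ(E_{t,γ}[u])` is the integral of the `L¹` modulus
`‖u(· + h) - u‖₁` against a radial kernel, and the substitution `t = r^(-(1 + γ))`, `h = r k` gives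
`t ν_γ(E_{t,γ}[u]) = ∫ w(k) ‖u(· + r k) - u‖₁ / r dk`, where `w(k) = |k|^(γ - N)` on
`{|k|^(1 + γ) < 1}` no longer depends on `t`. As `r → 0`, the difference quotient in the direction
`k` sees `∫ |∇u · k|`, and averaging a radial weight over directions turns this into `K ‖∇u‖` with
`K = ∫ w(k) |k · e| dk = κ(1, N) / |γ + 1|`. For smooth functions this is Fatou's lemma together
with the fundamental theorem of calculus; mollification, which increases neither the translation
moduli nor the variation, extends it to every bounded measurable function.

The value differs from `κ(1, N) ‖∇u‖ / |γ|` unless `γ = -1/2`, so the indicator of a ball is a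
counterexample wherever this limit applies. In the remaining range `-1 ≤ γ < 0`, `t → 0⁺`, the
measures `ν_γ(E_{t,γ}[u])` are bounded by the fractional perimeter of order `-γ`, which is finite
for `γ > -1`; at `γ = -1` they are constant for `t < 1`. The limit is therefore `0` or `∞`.
-/

section TranslationDefect

variable {E : Type*} [AddGroup E] [MeasureSpace E]

/-- The `L¹` modulus `∫ |u (x + h) - u x| dx` of the translation by `h`. -/
def translationDefect (u : E → ℝ) (h : E) : ℝ≥0∞ := ∫⁻ x, ‖u (x + h) - u x‖ₑ

theorem measurable_translationDefect [MeasurableAdd₂ E] [SFinite (volume : Measure E)]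
    {u : E → ℝ} (hu : Measurable u) : Measurable (translationDefect u) := by
  have : Measurable fun p : E × E => ‖u (p.2 + p.1) - u p.2‖ₑ := by fun_prop
  exact this.lintegral_prod_right'

theorem translationDefect_le_liminf [MeasurableAdd E] [(volume : Measure E).IsAddRightInvariant]
    {v : ℕ → E → ℝ} {u : E → ℝ} (hv : ∀ n, Measurable (v n))
    (hvu : ∀ᵐ x, Tendsto (fun n => v n x) atTop (𝓝 (u x))) (h : E) :
    translationDefect u h ≤ liminf (fun n => translationDefect (v n) h) atTop := by
  have hshift : ∀ᵐ x, Tendsto (fun n => v n (x + h)) atTop (𝓝 (u (x + h))) :=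
    (measurePreserving_add_right volume h).quasiMeasurePreserving.ae hvu
  calc translationDefect u h
      = ∫⁻ x, liminf (fun n => ‖v n (x + h) - v n x‖ₑ) atTop := by
        refine lintegral_congr_ae ?_
        filter_upwards [hvu, hshift] with x hx hxh
        exact (hxh.sub hx).enorm.liminf_eq.symm
    _ ≤ liminf (fun n => translationDefect (v n) h) atTop :=
        lintegral_liminf_le fun n => by have := hv n; fun_prop

end TranslationDefect

section TranslationEnergy

variable {E : Type*} [NormedAddCommGroup E] [NormedSpace ℝ E]

theorem tendsto_enorm_sub_div {v : E → ℝ} (hv : Differentiable ℝ v) (x k : E) :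
    Tendsto (fun r : ℝ => ‖v (x + r • k) - v x‖ₑ / ENNReal.ofReal r) (𝓝[>] 0)
      (𝓝 ‖fderiv ℝ v x k‖ₑ) := by
  refine (((hv x).hasFDerivAt.hasLineDerivAt k).tendsto_slope_zero_right.enorm).congr' ?_
  filter_upwards [self_mem_nhdsWithin] with r (hr : 0 < r)
  rw [smul_eq_mul, enorm_mul, enorm_inv hr.ne', Real.enorm_of_nonneg hr.le,
    ENNReal.div_eq_inv_mul]

theorem enorm_sub_le_lintegral_fderiv {v : E → ℝ} (hv : ContDiff ℝ 1 v) (x h : E) :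
    ‖v (x + h) - v x‖ₑ ≤ ∫⁻ τ in Icc (0 : ℝ) 1, ‖fderiv ℝ v (x + τ • h) h‖ₑ := by
  have hderiv (τ : ℝ) : HasDerivAt (fun τ : ℝ => v (x + τ • h)) (fderiv ℝ v (x + τ • h) h) τ := by
    have hline : HasDerivAt (fun τ : ℝ => x + τ • h) h τ := by
      simpa using ((hasDerivAt_id τ).smul_const h).const_add x
    exact (hv.differentiable one_ne_zero _).hasFDerivAt.comp_hasDerivAt τ hline
  have hcont : Continuous fun τ : ℝ => fderiv ℝ v (x + τ • h) h :=
    ((hv.continuous_fderiv one_ne_zero).comp (by fun_prop)).clm_apply continuous_const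
  have hftc := intervalIntegral.integral_eq_sub_of_hasDerivAt (a := 0) (b := 1)
    (fun τ _ => hderiv τ) (hcont.intervalIntegrable 0 1)
  simp only [one_smul, zero_smul, add_zero] at hftc
  rw [← hftc, intervalIntegral.integral_of_le zero_le_one, ← integral_Icc_eq_integral_Ioc]
  exact enorm_integral_le_lintegral_enorm _

variable [MeasureSpace E]

/-- The `L¹` difference quotient `∫ |u (x + r k) - u x| dx / r` at scale `r`, averaged over the
direction vector `k` against the weight `w`. -/
def translationEnergy (w : E → ℝ≥0∞) (u : E → ℝ) (r : ℝ) : ℝ≥0∞ :=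
  ∫⁻ k, w k * (translationDefect u (r • k) / ENNReal.ofReal r)

/-- The weight `w` integrates `|L k|` to `K ‖L‖` for every linear form `L`. -/
def IsIsotropicWeight (w : E → ℝ≥0∞) (K : ℝ≥0∞) : Prop :=
  Measurable w ∧ ∀ L : E →L[ℝ] ℝ, ∫⁻ k, w k * ‖L k‖ₑ = K * ‖L‖ₑ

variable [BorelSpace E]

theorem lintegral_fderiv_apply_le_liminf {v : E → ℝ} (hv : ContDiff ℝ 1 v) (k : E) :
    ∫⁻ x, ‖fderiv ℝ v x k‖ₑ ≤
      liminf (fun r : ℝ => translationDefect v (r • k) / ENNReal.ofReal r) (𝓝[>] 0) := by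
  have hmeas (r : ℝ) : Measurable fun x => ‖v (x + r • k) - v x‖ₑ :=
    ((hv.continuous.comp (continuous_add_const _)).sub hv.continuous).enorm.measurable
  calc ∫⁻ x, ‖fderiv ℝ v x k‖ₑ
      = ∫⁻ x, liminf (fun r : ℝ => ‖v (x + r • k) - v x‖ₑ / ENNReal.ofReal r) (𝓝[>] 0) :=
        lintegral_congr fun x =>
          (tendsto_enorm_sub_div (hv.differentiable one_ne_zero) x k).liminf_eq.symm
    _ ≤ liminf (fun r : ℝ => ∫⁻ x, ‖v (x + r • k) - v x‖ₑ / ENNReal.ofReal r) (𝓝[>] 0) :=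
        lintegral_liminf_le fun r => (hmeas r).div_const _
    _ = liminf (fun r : ℝ => translationDefect v (r • k) / ENNReal.ofReal r) (𝓝[>] 0) := by
        simp_rw [div_eq_mul_inv, lintegral_mul_const _ (hmeas _), translationDefect]

variable [FiniteDimensional ℝ E] [(volume : Measure E).IsAddHaarMeasure]

theorem translationEnergy_le_liminf {w : E → ℝ≥0∞} (hw : Measurable w) {v : ℕ → E → ℝ}
    {u : E → ℝ} (hv : ∀ n, Measurable (v n))
    (hvu : ∀ᵐ x, Tendsto (fun n => v n x) atTop (𝓝 (u x))) (r : ℝ) :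
    translationEnergy w u r ≤ liminf (fun n => translationEnergy w (v n) r) atTop := by
  have hmeas (n : ℕ) := measurable_translationDefect (hv n)
  refine le_trans (lintegral_mono fun k => ?_)
    (lintegral_liminf_le fun n => by have := hmeas n; fun_prop)
  simp only [ENNReal.div_eq_inv_mul, ← mul_assoc]
  exact (mul_le_mul_right (translationDefect_le_liminf hv hvu _) _).trans
    (ENNReal.le_liminf_mul.trans' (by simp))

theorem translationDefect_le_lintegral_fderiv {v : E → ℝ} (hv : ContDiff ℝ 1 v) (h : E) :
    translationDefect v h ≤ ∫⁻ x, ‖fderiv ℝ v x h‖ₑ := by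
  have hcont : Continuous (fderiv ℝ v) := hv.continuous_fderiv one_ne_zero
  calc translationDefect v h
      ≤ ∫⁻ x, ∫⁻ τ in Icc (0 : ℝ) 1, ‖fderiv ℝ v (x + τ • h) h‖ₑ :=
        lintegral_mono fun x => enorm_sub_le_lintegral_fderiv hv x h
    _ = ∫⁻ τ in Icc (0 : ℝ) 1, ∫⁻ x, ‖fderiv ℝ v (x + τ • h) h‖ₑ := by
        have : Continuous fun p : E × ℝ => fderiv ℝ v (p.1 + p.2 • h) h :=
          (hcont.comp (by fun_prop)).clm_apply continuous_const
        exact lintegral_lintegral_swap this.enorm.aemeasurable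
    _ = ∫⁻ _τ in Icc (0 : ℝ) 1, ∫⁻ x, ‖fderiv ℝ v x h‖ₑ :=
        lintegral_congr fun τ =>
          lintegral_add_right_eq_self (fun x => ‖fderiv ℝ v x h‖ₑ) (τ • h)
    _ = ∫⁻ x, ‖fderiv ℝ v x h‖ₑ := by simp

theorem lintegral_weight_mul_lintegral_fderiv {w : E → ℝ≥0∞} {K : ℝ≥0∞}
    (hw : IsIsotropicWeight w K) {v : E → ℝ} (hv : ContDiff ℝ 1 v) :
    ∫⁻ k, w k * ∫⁻ x, ‖fderiv ℝ v x k‖ₑ = K * ∫⁻ x, ‖fderiv ℝ v x‖ₑ := by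
  have hcont : Continuous (fderiv ℝ v) := hv.continuous_fderiv one_ne_zero
  have hcont₂ : Continuous fun p : E × E => fderiv ℝ v p.2 p.1 :=
    (hcont.comp continuous_snd).clm_apply continuous_fst
  calc ∫⁻ k, w k * ∫⁻ x, ‖fderiv ℝ v x k‖ₑ
      = ∫⁻ k, ∫⁻ x, w k * ‖fderiv ℝ v x k‖ₑ :=
        lintegral_congr fun k => (lintegral_const_mul _
          (hcont.clm_apply continuous_const).enorm.measurable).symm
    _ = ∫⁻ x, ∫⁻ k, w k * ‖fderiv ℝ v x k‖ₑ :=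
        lintegral_lintegral_swap
          ((hw.1.comp measurable_fst).mul hcont₂.enorm.measurable).aemeasurable
    _ = ∫⁻ x, K * ‖fderiv ℝ v x‖ₑ := lintegral_congr fun x => hw.2 _
    _ = K * ∫⁻ x, ‖fderiv ℝ v x‖ₑ := lintegral_const_mul _ hcont.enorm.measurable

theorem translationEnergy_le_of_contDiff {w : E → ℝ≥0∞} {K : ℝ≥0∞} (hw : IsIsotropicWeight w K)
    {v : E → ℝ} (hv : ContDiff ℝ 1 v) {r : ℝ} (hr : 0 < r) :
    translationEnergy w v r ≤ K * ∫⁻ x, ‖fderiv ℝ v x‖ₑ := by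
  rw [← lintegral_weight_mul_lintegral_fderiv hw hv]
  refine lintegral_mono fun k => mul_le_mul_right (ENNReal.div_le_of_le_mul ?_) _
  calc translationDefect v (r • k)
      ≤ ∫⁻ x, ‖fderiv ℝ v x (r • k)‖ₑ := translationDefect_le_lintegral_fderiv hv _
    _ = (∫⁻ x, ‖fderiv ℝ v x k‖ₑ) * ENNReal.ofReal r := by
        simp_rw [map_smul, smul_eq_mul, enorm_mul, Real.enorm_of_nonneg hr.le,
          lintegral_const_mul' _ _ ENNReal.ofReal_ne_top, mul_comm]

theorem le_liminf_translationEnergy_of_contDiff {w : E → ℝ≥0∞} {K : ℝ≥0∞}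
    (hw : IsIsotropicWeight w K) {v : E → ℝ} (hv : ContDiff ℝ 1 v) :
    K * ∫⁻ x, ‖fderiv ℝ v x‖ₑ ≤ liminf (translationEnergy w v) (𝓝[>] 0) := by
  calc K * ∫⁻ x, ‖fderiv ℝ v x‖ₑ
      = ∫⁻ k, w k * ∫⁻ x, ‖fderiv ℝ v x k‖ₑ := (lintegral_weight_mul_lintegral_fderiv hw hv).symm
    _ ≤ ∫⁻ k, liminf (fun r : ℝ => w k * (translationDefect v (r • k) / ENNReal.ofReal r))
          (𝓝[>] 0) :=
        lintegral_mono fun k => (mul_le_mul_right (lintegral_fderiv_apply_le_liminf hv k) _).trans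
          (ENNReal.le_liminf_mul.trans' (by simp))
    _ ≤ liminf (translationEnergy w v) (𝓝[>] 0) :=
        lintegral_liminf_le fun r => by
          have := measurable_translationDefect hv.continuous.measurable
          have := hw.1
          fun_prop

end TranslationEnergy

section IntegrationByParts

theorem integral_mul_fderiv_apply_eq_neg {E : Type*} [NormedAddCommGroup E] [NormedSpace ℝ E]
    [FiniteDimensional ℝ E] [MeasureSpace E] [BorelSpace E] [(volume : Measure E).IsAddHaarMeasure]
    {v f : E → ℝ} (hv : ContDiff ℝ 1 v) (hf : ContDiff ℝ 1 f) (hfc : HasCompactSupport f) (k : E) :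
    ∫ x, v x * fderiv ℝ f x k = -∫ x, fderiv ℝ v x k * f x := by
  have hv' : Continuous fun x => fderiv ℝ v x k :=
    (hv.continuous_fderiv one_ne_zero).clm_apply continuous_const
  have hf' : Continuous fun x => fderiv ℝ f x k :=
    (hf.continuous_fderiv one_ne_zero).clm_apply continuous_const
  exact integral_mul_fderiv_eq_neg_fderiv_mul_of_integrable
    ((hv'.mul hf.continuous).integrable_of_hasCompactSupport hfc.mul_left)
    ((hv.continuous.mul hf').integrable_of_hasCompactSupport
      (hfc.fderiv_apply (𝕜 := ℝ) k).mul_left)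
    ((hv.continuous.mul hf.continuous).integrable_of_hasCompactSupport hfc.mul_left)
    (fun x _ => hv.differentiable one_ne_zero x) (fun x _ => hf.differentiable one_ne_zero x)

variable {N : ℕ} {φ : EuclideanSpace ℝ (Fin N) → EuclideanSpace ℝ (Fin N)}

theorem divergence_eq_sum_fderiv (hφ : Differentiable ℝ φ) (x : EuclideanSpace ℝ (Fin N)) :
    divergence φ x = ∑ i, fderiv ℝ (fun y => φ y i) x (EuclideanSpace.single i (1 : ℝ)) := by
  refine Finset.sum_congr rfl fun i _ => ?_
  have hcoord : HasFDerivAt (fun y => φ y i)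
      ((EuclideanSpace.proj i : EuclideanSpace ℝ (Fin N) →L[ℝ] ℝ).comp (fderiv ℝ φ x)) x :=
    (EuclideanSpace.proj i : EuclideanSpace ℝ (Fin N) →L[ℝ] ℝ).hasFDerivAt.comp x
      (hφ x).hasFDerivAt
  rw [hcoord.fderiv]
  rfl

theorem continuous_divergence (hφ : ContDiff ℝ 1 φ) : Continuous (divergence φ) :=
  continuous_finsetSum _ fun i _ =>
    (EuclideanSpace.proj i : EuclideanSpace ℝ (Fin N) →L[ℝ] ℝ).continuous.comp
      ((hφ.continuous_fderiv one_ne_zero).clm_apply continuous_const)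

theorem hasCompactSupport_divergence (hφ : HasCompactSupport φ) :
    HasCompactSupport (divergence φ) :=
  (hφ.fderiv (𝕜 := ℝ)).comp_left
    (g := fun L : EuclideanSpace ℝ (Fin N) →L[ℝ] EuclideanSpace ℝ (Fin N) =>
      ∑ i, L (EuclideanSpace.single i 1) i) (by simp)

theorem integrable_divergence (hφ : ContDiff ℝ 1 φ) (hφc : HasCompactSupport φ) :
    Integrable (divergence φ) :=
  (continuous_divergence hφ).integrable_of_hasCompactSupport (hasCompactSupport_divergence hφc)

theorem apply_eq_sum_single_mul (L : EuclideanSpace ℝ (Fin N) →L[ℝ] ℝ)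
    (z : EuclideanSpace ℝ (Fin N)) : L z = ∑ i, L (EuclideanSpace.single i 1) * z i := by
  conv_lhs => rw [← (EuclideanSpace.basisFun (Fin N) ℝ).sum_repr z, map_sum]
  simp only [map_smul, EuclideanSpace.basisFun_apply, EuclideanSpace.basisFun_repr, smul_eq_mul,
    mul_comm]

theorem integral_mul_divergence {v : EuclideanSpace ℝ (Fin N) → ℝ} (hv : ContDiff ℝ 1 v)
    (hφ : ContDiff ℝ 1 φ) (hφc : HasCompactSupport φ) :
    ∫ x, v x * divergence φ x = -∫ x, fderiv ℝ v x (φ x) := by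
  have hcoord (i : Fin N) : ContDiff ℝ 1 fun y => φ y i :=
    (EuclideanSpace.proj i : EuclideanSpace ℝ (Fin N) →L[ℝ] ℝ).contDiff.comp hφ
  have hcompact (i : Fin N) : HasCompactSupport fun y => φ y i :=
    hφc.comp_left (g := fun z : EuclideanSpace ℝ (Fin N) => z i) (by simp)
  have hint₁ (i : Fin N) : Integrable fun x =>
      v x * fderiv ℝ (fun y => φ y i) x (EuclideanSpace.single i 1) :=
    (hv.continuous.mul (((hcoord i).continuous_fderiv one_ne_zero).clm_apply
      continuous_const)).integrable_of_hasCompactSupport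
        ((hcompact i).fderiv_apply (𝕜 := ℝ) _).mul_left
  have hint₂ (i : Fin N) : Integrable fun x =>
      fderiv ℝ v x (EuclideanSpace.single i 1) * φ x i :=
    (((hv.continuous_fderiv one_ne_zero).clm_apply continuous_const).mul
      (hcoord i).continuous).integrable_of_hasCompactSupport (hcompact i).mul_left
  simp_rw [fun x => apply_eq_sum_single_mul (fderiv ℝ v x) (φ x),
    divergence_eq_sum_fderiv (hφ.differentiable one_ne_zero), Finset.mul_sum]
  rw [integral_finsetSum _ fun i _ => hint₁ i, integral_finsetSum _ fun i _ => hint₂ i,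
    ← Finset.sum_neg_distrib]
  exact Finset.sum_congr rfl fun i _ =>
    integral_mul_fderiv_apply_eq_neg hv (hcoord i) (hcompact i) _

end IntegrationByParts

section GradVariation

variable {N : ℕ}

theorem enorm_integral_mul_divergence_le (u : EuclideanSpace ℝ (Fin N) → ℝ)
    {φ : EuclideanSpace ℝ (Fin N) → EuclideanSpace ℝ (Fin N)} (hφ : ContDiff ℝ 1 φ)
    (hφc : HasCompactSupport φ) (hφ₁ : ∀ x, ‖φ x‖ ≤ 1) :
    ‖∫ x, u x * divergence φ x‖ₑ ≤ gradVariation u := by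
  rw [← ofReal_norm, Real.norm_eq_abs]
  exact le_iSup₂ (f := fun φ _ => ENNReal.ofReal |∫ x, u x * divergence φ x|) φ ⟨hφ, hφc, hφ₁⟩

theorem gradVariation_le {u : EuclideanSpace ℝ (Fin N) → ℝ} {C : ℝ≥0∞}
    (h : ∀ φ : EuclideanSpace ℝ (Fin N) → EuclideanSpace ℝ (Fin N), ContDiff ℝ 1 φ →
      HasCompactSupport φ → (∀ x, ‖φ x‖ ≤ 1) → ‖∫ x, u x * divergence φ x‖ₑ ≤ C) :
    gradVariation u ≤ C :=
  iSup₂_le fun φ hφ => by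
    simpa only [← ofReal_norm, Real.norm_eq_abs] using h φ hφ.1 hφ.2.1 hφ.2.2

theorem gradVariation_le_liminf {v : ℕ → EuclideanSpace ℝ (Fin N) → ℝ}
    {u : EuclideanSpace ℝ (Fin N) → ℝ} {M : ℝ} (hv : ∀ n, Measurable (v n))
    (hM : ∀ n x, ‖v n x‖ ≤ M) (hvu : ∀ᵐ x, Tendsto (fun n => v n x) atTop (𝓝 (u x))) :
    gradVariation u ≤ liminf (fun n => gradVariation (v n)) atTop := by
  refine gradVariation_le fun φ hφ hφc hφ₁ => ?_
  have hlim : Tendsto (fun n => ∫ x, v n x * divergence φ x) atTop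
      (𝓝 (∫ x, u x * divergence φ x)) := by
    refine tendsto_integral_of_dominated_convergence (fun x => M * ‖divergence φ x‖)
      (fun n => ((hv n).mul (continuous_divergence hφ).measurable).aestronglyMeasurable)
      ((integrable_divergence hφ hφc).norm.const_mul M)
      (fun n => Eventually.of_forall fun x => ?_)
      (hvu.mono fun x hx => hx.mul_const _)
    rw [norm_mul]
    gcongr
    exact hM n x
  rw [← hlim.enorm.liminf_eq]
  exact liminf_le_liminf
    (Eventually.of_forall fun n => enorm_integral_mul_divergence_le (v n) hφ hφc hφ₁)

theorem gradVariation_le_lintegral_fderiv {v : EuclideanSpace ℝ (Fin N) → ℝ}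
    (hv : ContDiff ℝ 1 v) : gradVariation v ≤ ∫⁻ x, ‖fderiv ℝ v x‖ₑ := by
  refine gradVariation_le fun φ hφ hφc hφ₁ => ?_
  rw [integral_mul_divergence hv hφ hφc, enorm_neg]
  refine (enorm_integral_le_lintegral_enorm _).trans (lintegral_mono fun x => ?_)
  rw [← ofReal_norm, ← ofReal_norm]
  exact ENNReal.ofReal_le_ofReal ((fderiv ℝ v x).unit_le_opNorm _ (hφ₁ x))

/-- A regularization of the unit vector field `-∇v / |∇v|`, which is defined and differentiable at
the critical points of `v` too. -/
def regularizedDirection (v : EuclideanSpace ℝ (Fin N) → ℝ) (η : ℝ)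
    (x : EuclideanSpace ℝ (Fin N)) : EuclideanSpace ℝ (Fin N) :=
  -(√(‖gradient v x‖ ^ 2 + η ^ 2))⁻¹ • gradient v x

theorem contDiff_regularizedDirection {v : EuclideanSpace ℝ (Fin N) → ℝ} (hv : ContDiff ℝ 2 v)
    {η : ℝ} (hη : η ≠ 0) : ContDiff ℝ 1 (regularizedDirection v η) := by
  have hgrad : ContDiff ℝ 1 (gradient v) :=
    (InnerProductSpace.toDual ℝ (EuclideanSpace ℝ (Fin N))).symm.contDiff.comp
      (hv.fderiv_right (m := 1) (by norm_num))
  have hsqrt : ContDiff ℝ 1 fun x => √(‖gradient v x‖ ^ 2 + η ^ 2) :=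
    ((hgrad.norm_sq ℝ).add contDiff_const).sqrt fun x => by positivity
  exact (hsqrt.inv fun x => by positivity).neg.smul hgrad

theorem norm_regularizedDirection_le (v : EuclideanSpace ℝ (Fin N) → ℝ) (η : ℝ)
    (x : EuclideanSpace ℝ (Fin N)) : ‖regularizedDirection v η x‖ ≤ 1 := by
  rw [regularizedDirection, norm_smul, norm_neg, norm_inv, Real.norm_of_nonneg (Real.sqrt_nonneg _),
    inv_mul_eq_div]
  exact div_le_one_of_le₀ (Real.le_sqrt_of_sq_le (le_add_of_nonneg_right (sq_nonneg η)))
    (Real.sqrt_nonneg _)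

theorem neg_fderiv_regularizedDirection (v : EuclideanSpace ℝ (Fin N) → ℝ) (η : ℝ)
    (x : EuclideanSpace ℝ (Fin N)) : -fderiv ℝ v x (regularizedDirection v η x) =
      ‖fderiv ℝ v x‖ ^ 2 / √(‖fderiv ℝ v x‖ ^ 2 + η ^ 2) := by
  have hnorm : ‖gradient v x‖ = ‖fderiv ℝ v x‖ := LinearIsometryEquiv.norm_map _ _
  have happly : fderiv ℝ v x (gradient v x) = ‖fderiv ℝ v x‖ ^ 2 := by
    rw [← hnorm, ← real_inner_self_eq_norm_sq]
    exact (InnerProductSpace.toDual_symm_apply (x := gradient v x) (y := fderiv ℝ v x)).symm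
  rw [regularizedDirection, map_smul, happly, hnorm, smul_eq_mul]
  ring

theorem lintegral_bump_mul_le_gradVariation {v : EuclideanSpace ℝ (Fin N) → ℝ}
    (hv : ContDiff ℝ 2 v) {c : EuclideanSpace ℝ (Fin N)} (χ : ContDiffBump c) {η : ℝ}
    (hη : η ≠ 0) :
    ∫⁻ x, ENNReal.ofReal (χ x * (‖fderiv ℝ v x‖ ^ 2 / √(‖fderiv ℝ v x‖ ^ 2 + η ^ 2))) ≤
      gradVariation v := by
  have hcont : Continuous (fderiv ℝ v) := hv.continuous_fderiv two_ne_zero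
  have hφ : ContDiff ℝ 1 fun x => χ x • regularizedDirection v η x :=
    χ.contDiff.smul (contDiff_regularizedDirection hv hη)
  have hφc : HasCompactSupport fun x => χ x • regularizedDirection v η x :=
    χ.hasCompactSupport.smul_right
  have hφ₁ (x : EuclideanSpace ℝ (Fin N)) : ‖χ x • regularizedDirection v η x‖ ≤ 1 := by
    rw [norm_smul, Real.norm_of_nonneg χ.nonneg]
    exact mul_le_one₀ χ.le_one (norm_nonneg _) (norm_regularizedDirection_le v η x)
  have hpair (x : EuclideanSpace ℝ (Fin N)) :
      -fderiv ℝ v x (χ x • regularizedDirection v η x) =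
        χ x * (‖fderiv ℝ v x‖ ^ 2 / √(‖fderiv ℝ v x‖ ^ 2 + η ^ 2)) := by
    rw [map_smul, smul_eq_mul, ← mul_neg, neg_fderiv_regularizedDirection]
  have hnonneg (x : EuclideanSpace ℝ (Fin N)) :
      0 ≤ χ x * (‖fderiv ℝ v x‖ ^ 2 / √(‖fderiv ℝ v x‖ ^ 2 + η ^ 2)) :=
    mul_nonneg χ.nonneg (by positivity)
  have hint : Integrable fun x => χ x * (‖fderiv ℝ v x‖ ^ 2 / √(‖fderiv ℝ v x‖ ^ 2 + η ^ 2)) :=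
    (χ.continuous.mul ((hcont.norm.pow 2).div (by fun_prop)
      fun x => by positivity)).integrable_of_hasCompactSupport χ.hasCompactSupport.mul_right
  have hdual := enorm_integral_mul_divergence_le v hφ hφc hφ₁
  rw [integral_mul_divergence (hv.of_le one_le_two) hφ hφc, ← integral_neg] at hdual
  simp_rw [hpair] at hdual
  rwa [← ofReal_integral_eq_lintegral_ofReal hint (Eventually.of_forall hnonneg),
    ← Real.enorm_of_nonneg (integral_nonneg hnonneg)]

theorem tendsto_sq_div_sqrt_sq_add_sq {a : ℝ} (ha : 0 ≤ a) :
    Tendsto (fun η : ℝ => a ^ 2 / √(a ^ 2 + η ^ 2)) (𝓝 0) (𝓝 a) := by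
  rcases ha.eq_or_lt with rfl | ha
  · simp
  have hcont : ContinuousAt (fun η : ℝ => a ^ 2 / √(a ^ 2 + η ^ 2)) 0 :=
    ContinuousAt.div (by fun_prop) (by fun_prop) (by positivity)
  convert hcont.tendsto using 2
  rw [zero_pow two_ne_zero, add_zero, Real.sqrt_sq ha.le, sq, mul_div_cancel_right₀ a ha.ne']

theorem lintegral_fderiv_le_gradVariation {v : EuclideanSpace ℝ (Fin N) → ℝ}
    (hv : ContDiff ℝ 2 v) : ∫⁻ x, ‖fderiv ℝ v x‖ₑ ≤ gradVariation v := by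
  have hcont : Continuous (fderiv ℝ v) := hv.continuous_fderiv two_ne_zero
  let χ (n : ℕ) : ContDiffBump (0 : EuclideanSpace ℝ (Fin N)) :=
    ⟨n + 1, n + 2, by positivity, by linarith⟩
  let F (n : ℕ) (x : EuclideanSpace ℝ (Fin N)) : ℝ :=
    χ n x * (‖fderiv ℝ v x‖ ^ 2 / √(‖fderiv ℝ v x‖ ^ 2 + (1 / ((n : ℝ) + 1)) ^ 2))
  have hlim (x : EuclideanSpace ℝ (Fin N)) :
      Tendsto (fun n => F n x) atTop (𝓝 ‖fderiv ℝ v x‖) := by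
    refine ((tendsto_sq_div_sqrt_sq_add_sq (norm_nonneg (fderiv ℝ v x))).comp
      tendsto_one_div_add_atTop_nhds_zero_nat).congr' ?_
    obtain ⟨m, hm⟩ := exists_nat_ge ‖x‖
    filter_upwards [eventually_ge_atTop m] with n hn
    have hx : x ∈ Metric.closedBall 0 (χ n).rIn := by
      have : (m : ℝ) ≤ n := by exact_mod_cast hn
      exact mem_closedBall_zero_iff.2 (by linarith : ‖x‖ ≤ (n : ℝ) + 1)
    simp [F, (χ n).one_of_mem_closedBall hx]
  calc ∫⁻ x, ‖fderiv ℝ v x‖ₑ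
      = ∫⁻ x, liminf (fun n => ENNReal.ofReal (F n x)) atTop := by
        refine lintegral_congr fun x => ?_
        rw [← ofReal_norm]
        exact (ENNReal.tendsto_ofReal (hlim x)).liminf_eq.symm
    _ ≤ liminf (fun n => ∫⁻ x, ENNReal.ofReal (F n x)) atTop :=
        lintegral_liminf_le fun n => by
          have := hcont.measurable
          have := (χ n).continuous.measurable
          fun_prop
    _ ≤ gradVariation v :=
        (liminf_le_liminf (v := fun _ => gradVariation v) (Eventually.of_forall fun n =>
          lintegral_bump_mul_le_gradVariation hv (χ n) (by positivity))).trans_eq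
            (liminf_const _)

end GradVariation

section Convolution

variable {E : Type*} [NormedAddCommGroup E] [MeasureSpace E] [BorelSpace E]

theorem integrable_mul_comp_sub [SecondCountableTopology E] {ρ u : E → ℝ} (hρ : Integrable ρ)
    (hu : Measurable u) {M : ℝ} (hM : ∀ x, ‖u x‖ ≤ M) (x : E) :
    Integrable fun y => ρ y * u (x - y) :=
  hρ.mul_bdd (c := M) (hu.comp (measurable_const.sub measurable_id)).aestronglyMeasurable
    (Eventually.of_forall fun _ => hM _)

variable [NormedSpace ℝ E] [FiniteDimensional ℝ E] [(volume : Measure E).IsAddHaarMeasure]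

theorem translationDefect_convolution_le {ρ u : E → ℝ} (hρ : Integrable ρ) (hu : Measurable u)
    {M : ℝ} (hM : ∀ x, ‖u x‖ ≤ M) (h : E) :
    translationDefect (ρ ⋆ u) h ≤ (∫⁻ y, ‖ρ y‖ₑ) * translationDefect u h := by
  have : SecondCountableTopology E := secondCountable_of_proper
  calc translationDefect (ρ ⋆ u) h
      ≤ ∫⁻ x, ∫⁻ y, ‖ρ y‖ₑ * ‖u (x - y + h) - u (x - y)‖ₑ := by
        refine lintegral_mono fun x => ?_
        simp only [convolution_def, ContinuousLinearMap.lsmul_apply, smul_eq_mul]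
        rw [← integral_sub (integrable_mul_comp_sub hρ hu hM _)
          (integrable_mul_comp_sub hρ hu hM _)]
        refine (enorm_integral_le_lintegral_enorm _).trans_eq (lintegral_congr fun y => ?_)
        rw [← mul_sub, enorm_mul, add_sub_right_comm]
    _ = ∫⁻ y, ∫⁻ x, ‖ρ y‖ₑ * ‖u (x - y + h) - u (x - y)‖ₑ := by
        have hmeas : Measurable fun p : E × E => ‖u (p.1 - p.2 + h) - u (p.1 - p.2)‖ₑ := by fun_prop
        exact lintegral_lintegral_swap
          (hρ.aestronglyMeasurable.enorm.comp_snd.mul hmeas.aemeasurable)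
    _ = ∫⁻ y, ‖ρ y‖ₑ * translationDefect u h := by
        refine lintegral_congr fun y => ?_
        rw [lintegral_const_mul _ (by fun_prop),
          lintegral_sub_right_eq_self (fun x => ‖u (x + h) - u x‖ₑ) y, translationDefect]
    _ = (∫⁻ y, ‖ρ y‖ₑ) * translationDefect u h :=
        lintegral_mul_const'' _ hρ.aestronglyMeasurable.enorm

end Convolution

section ConvolutionVariation

variable {N : ℕ}

theorem enorm_integral_comp_sub_mul_divergence_le (u : EuclideanSpace ℝ (Fin N) → ℝ)
    {φ : EuclideanSpace ℝ (Fin N) → EuclideanSpace ℝ (Fin N)} (hφ : ContDiff ℝ 1 φ)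
    (hφc : HasCompactSupport φ) (hφ₁ : ∀ x, ‖φ x‖ ≤ 1) (y : EuclideanSpace ℝ (Fin N)) :
    ‖∫ x, u (x - y) * divergence φ x‖ₑ ≤ gradVariation u := by
  have hshift := integral_sub_right_eq_self (μ := volume) (fun x => u x * divergence φ (x + y)) y
  simp only [sub_add_cancel] at hshift
  have hdiv (x : EuclideanSpace ℝ (Fin N)) :
      divergence φ (x + y) = divergence (fun z => φ (z + y)) x := by
    simp only [divergence, fderiv_comp_add_right]
  simp_rw [hshift, hdiv]
  exact enorm_integral_mul_divergence_le u (hφ.comp (contDiff_id.add contDiff_const))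
    (hφc.comp_homeomorph (Homeomorph.addRight y)) fun x => hφ₁ _

theorem integral_convolution_mul_divergence {ρ u : EuclideanSpace ℝ (Fin N) → ℝ}
    (hρ : Integrable ρ) (hu : Measurable u) {M : ℝ} (hM : ∀ x, ‖u x‖ ≤ M)
    {φ : EuclideanSpace ℝ (Fin N) → EuclideanSpace ℝ (Fin N)} (hφ : ContDiff ℝ 1 φ)
    (hφc : HasCompactSupport φ) :
    ∫ x, (ρ ⋆ u) x * divergence φ x = ∫ y, ρ y * ∫ x, u (x - y) * divergence φ x := by
  have hint : Integrable (fun p : EuclideanSpace ℝ (Fin N) × EuclideanSpace ℝ (Fin N) =>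
      ρ p.2 * u (p.1 - p.2) * divergence φ p.1) (volume.prod volume) := by
    refine ((((integrable_divergence hφ hφc).mul_prod hρ).mul_bdd (c := M)
      (hu.comp measurable_sub).aestronglyMeasurable
      (Eventually.of_forall fun p => hM (p.1 - p.2)))).congr (Eventually.of_forall fun p => ?_)
    dsimp only
    rw [Function.comp_apply]
    ring
  simp only [convolution_def, ContinuousLinearMap.lsmul_apply, smul_eq_mul]
  simp_rw [← integral_mul_const, ← integral_const_mul]
  rw [integral_integral_swap hint]
  simp_rw [mul_assoc]

theorem gradVariation_convolution_le {ρ u : EuclideanSpace ℝ (Fin N) → ℝ}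
    (hρ : Integrable ρ) (hu : Measurable u) {M : ℝ} (hM : ∀ x, ‖u x‖ ≤ M) :
    gradVariation (ρ ⋆ u) ≤ (∫⁻ y, ‖ρ y‖ₑ) * gradVariation u := by
  refine gradVariation_le fun φ hφ hφc hφ₁ => ?_
  rw [integral_convolution_mul_divergence hρ hu hM hφ hφc,
    ← lintegral_mul_const'' _ hρ.aestronglyMeasurable.enorm]
  refine (enorm_integral_le_lintegral_enorm _).trans (lintegral_mono fun y => ?_)
  rw [enorm_mul]
  gcongr
  exact enorm_integral_comp_sub_mul_divergence_le u hφ hφc hφ₁ y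

end ConvolutionVariation

section Mollification

theorem locallyIntegrable_of_bounded {E : Type*} [TopologicalSpace E] [MeasureSpace E]
    [IsLocallyFiniteMeasure (volume : Measure E)] {u : E → ℝ} (hu : Measurable u) {M : ℝ}
    (hM : ∀ x, ‖u x‖ ≤ M) : LocallyIntegrable u :=
  (locallyIntegrable_const M).mono hu.aestronglyMeasurable
    (Eventually.of_forall fun x => (hM x).trans (le_abs_self M))

/-- A bump function supported in the ball of radius `2 / (n + 1)`; normalized, it is the kernel of
`mollify n`. -/
def mollifier (E : Type*) [NormedAddCommGroup E] (n : ℕ) : ContDiffBump (0 : E) where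
  rIn := 1 / ((n : ℝ) + 1)
  rOut := 2 * (1 / ((n : ℝ) + 1))
  rIn_pos := by positivity
  rIn_lt_rOut := lt_mul_of_one_lt_left (by positivity) one_lt_two

variable {E : Type*} [NormedAddCommGroup E] [NormedSpace ℝ E] [FiniteDimensional ℝ E]
  [MeasureSpace E] [BorelSpace E] [(volume : Measure E).IsAddHaarMeasure]

/-- Smooth approximations of `u`, by convolution with the probability densities of shrinking
support given by `mollifier`. -/
def mollify (n : ℕ) (u : E → ℝ) : E → ℝ := (mollifier E n).normed volume ⋆ u

theorem lintegral_enorm_mollifier (n : ℕ) : ∫⁻ x, ‖(mollifier E n).normed volume x‖ₑ = 1 := by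
  rw [← ofReal_integral_norm_eq_lintegral_enorm (mollifier E n).integrable_normed]
  simp_rw [Real.norm_of_nonneg ((mollifier E n).nonneg_normed _), (mollifier E n).integral_normed,
    ENNReal.ofReal_one]

theorem contDiff_mollify {u : E → ℝ} (hu : LocallyIntegrable u) (n : ℕ) {k : ℕ∞} :
    ContDiff ℝ k (mollify n u) :=
  (mollifier E n).hasCompactSupport_normed.contDiff_convolution_left _
    (mollifier E n).contDiff_normed hu

theorem norm_mollify_le {u : E → ℝ} {M : ℝ} (hM : ∀ x, ‖u x‖ ≤ M) (n : ℕ) (x : E) :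
    ‖mollify n u x‖ ≤ M := by
  have hint := (mollifier E n).integrable_normed (μ := volume)
  rw [mollify, convolution_def, ← one_mul M, ← (mollifier E n).integral_normed (μ := volume),
    ← integral_mul_const]
  refine norm_integral_le_of_norm_le (hint.mul_const M) (Eventually.of_forall fun y => ?_)
  rw [ContinuousLinearMap.lsmul_apply, norm_smul,
    Real.norm_of_nonneg ((mollifier E n).nonneg_normed y)]
  exact mul_le_mul_of_nonneg_left (hM _) ((mollifier E n).nonneg_normed y)

theorem ae_tendsto_mollify {u : E → ℝ} (hu : LocallyIntegrable u) :
    ∀ᵐ x, Tendsto (fun n => mollify n u x) atTop (𝓝 (u x)) := by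
  refine ContDiffBump.ae_convolution_tendsto_right_of_locallyIntegrable (K := 2) ?_
    (Eventually.of_forall fun n => le_rfl) hu
  simpa only [mul_zero, mollifier] using
    (tendsto_one_div_add_atTop_nhds_zero_nat (𝕜 := ℝ)).const_mul 2

theorem translationDefect_mollify_le {u : E → ℝ} (hu : Measurable u) {M : ℝ}
    (hM : ∀ x, ‖u x‖ ≤ M) (n : ℕ) (h : E) :
    translationDefect (mollify n u) h ≤ translationDefect u h := by
  simpa only [mollify, lintegral_enorm_mollifier, one_mul] using
    translationDefect_convolution_le (mollifier E n).integrable_normed hu hM h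

theorem lintegral_fderiv_mollify_le {N : ℕ} {u : EuclideanSpace ℝ (Fin N) → ℝ}
    (hu : Measurable u) {M : ℝ} (hM : ∀ x, ‖u x‖ ≤ M) (n : ℕ) :
    ∫⁻ x, ‖fderiv ℝ (mollify n u) x‖ₑ ≤ gradVariation u :=
  calc ∫⁻ x, ‖fderiv ℝ (mollify n u) x‖ₑ
      ≤ gradVariation (mollify n u) :=
        lintegral_fderiv_le_gradVariation
          (contDiff_mollify (locallyIntegrable_of_bounded hu hM) n (k := 2))
    _ ≤ gradVariation u := by
        simpa only [mollify, lintegral_enorm_mollifier, one_mul] using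
          gradVariation_convolution_le
            (mollifier (EuclideanSpace ℝ (Fin N)) n).integrable_normed hu hM

end Mollification

section EnergyBounds

variable {N : ℕ} {u : EuclideanSpace ℝ (Fin N) → ℝ} {M : ℝ}

theorem gradVariation_le_liminf_lintegral_fderiv_mollify (hu : Measurable u)
    (hM : ∀ x, ‖u x‖ ≤ M) :
    gradVariation u ≤ liminf (fun n => ∫⁻ x, ‖fderiv ℝ (mollify n u) x‖ₑ) atTop := by
  have hloc := locallyIntegrable_of_bounded hu hM
  refine (gradVariation_le_liminf
    (fun n => (contDiff_mollify hloc n (k := 1)).continuous.measurable)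
    (norm_mollify_le hM) (ae_tendsto_mollify hloc)).trans (liminf_le_liminf ?_)
  exact Eventually.of_forall fun n => gradVariation_le_lintegral_fderiv (contDiff_mollify hloc n)

theorem enorm_le_sum_enorm_apply_single (L : EuclideanSpace ℝ (Fin N) →L[ℝ] ℝ) :
    ‖L‖ₑ ≤ ∑ i, ‖L (EuclideanSpace.single i 1)‖ₑ := by
  simp_rw [← ofReal_norm]
  rw [← ENNReal.ofReal_sum_of_nonneg fun i _ => norm_nonneg _]
  refine ENNReal.ofReal_le_ofReal (L.opNorm_le_bound (by positivity) fun z => ?_)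
  rw [apply_eq_sum_single_mul L z, Finset.sum_mul]
  refine norm_sum_le_of_le _ fun i _ => ?_
  rw [norm_mul]
  exact mul_le_mul_of_nonneg_left (PiLp.norm_apply_le z i) (norm_nonneg _)

theorem gradVariation_le_of_translationDefect_le (hu : Measurable u) (hM : ∀ x, ‖u x‖ ≤ M)
    {C : ℝ≥0∞} (hC : ∀ᶠ h in 𝓝 0, translationDefect u h ≤ C * ‖h‖ₑ) :
    gradVariation u ≤ N * C := by
  have hloc := locallyIntegrable_of_bounded hu hM
  have hpartial (n : ℕ) (i : Fin N) :
      ∫⁻ x, ‖fderiv ℝ (mollify n u) x (EuclideanSpace.single i 1)‖ₑ ≤ C := by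
    refine (lintegral_fderiv_apply_le_liminf (contDiff_mollify hloc n) _).trans ?_
    have hsmall : Tendsto (fun r : ℝ => r • EuclideanSpace.single i (1 : ℝ)) (𝓝[>] 0) (𝓝 0) := by
      have hcont : Continuous fun r : ℝ => r • EuclideanSpace.single i (1 : ℝ) := by fun_prop
      simpa only [zero_smul] using (hcont.tendsto 0).mono_left nhdsWithin_le_nhds
    refine (liminf_le_liminf ?_).trans_eq (liminf_const C)
    filter_upwards [hsmall.eventually hC, self_mem_nhdsWithin] with r hr (hr₀ : 0 < r)
    refine ENNReal.div_le_of_le_mul ((translationDefect_mollify_le hu hM n _).trans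
      (hr.trans_eq ?_))
    rw [enorm_smul, Real.enorm_of_nonneg hr₀.le, ← ofReal_norm, PiLp.norm_single,
      norm_one, ENNReal.ofReal_one, mul_one]
  refine (gradVariation_le_liminf_lintegral_fderiv_mollify hu hM).trans
    ((liminf_le_liminf (Eventually.of_forall fun n => ?_)).trans_eq (liminf_const (N * C)))
  calc ∫⁻ x, ‖fderiv ℝ (mollify n u) x‖ₑ
      ≤ ∫⁻ x, ∑ i, ‖fderiv ℝ (mollify n u) x (EuclideanSpace.single i 1)‖ₑ :=
        lintegral_mono fun x => enorm_le_sum_enorm_apply_single _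
    _ = ∑ i, ∫⁻ x, ‖fderiv ℝ (mollify n u) x (EuclideanSpace.single i 1)‖ₑ :=
        lintegral_finsetSum _ fun i _ => (((contDiff_mollify hloc n
          (k := 1)).continuous_fderiv one_ne_zero).clm_apply continuous_const).enorm.measurable
    _ ≤ ∑ _i : Fin N, C := Finset.sum_le_sum fun i _ => hpartial n i
    _ = N * C := by simp

variable {w : EuclideanSpace ℝ (Fin N) → ℝ≥0∞} {K : ℝ≥0∞}

theorem translationEnergy_le (hw : IsIsotropicWeight w K) (hu : Measurable u)
    (hM : ∀ x, ‖u x‖ ≤ M) {r : ℝ} (hr : 0 < r) :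
    translationEnergy w u r ≤ K * gradVariation u := by
  have hloc := locallyIntegrable_of_bounded hu hM
  calc translationEnergy w u r
      ≤ liminf (fun n => translationEnergy w (mollify n u) r) atTop :=
        translationEnergy_le_liminf hw.1
          (fun n => (contDiff_mollify hloc n (k := 1)).continuous.measurable)
          (ae_tendsto_mollify hloc) r
    _ ≤ liminf (fun _ : ℕ => K * gradVariation u) atTop :=
        liminf_le_liminf (Eventually.of_forall fun n =>
          (translationEnergy_le_of_contDiff hw (contDiff_mollify hloc n) hr).trans
            (mul_le_mul_right (lintegral_fderiv_mollify_le hu hM n) K))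
    _ = K * gradVariation u := liminf_const _

theorem le_liminf_translationEnergy (hw : IsIsotropicWeight w K) (hu : Measurable u)
    (hM : ∀ x, ‖u x‖ ≤ M) :
    K * gradVariation u ≤ liminf (translationEnergy w u) (𝓝[>] 0) := by
  have hloc := locallyIntegrable_of_bounded hu hM
  have hmollify (n : ℕ) : K * ∫⁻ x, ‖fderiv ℝ (mollify n u) x‖ₑ ≤
      liminf (translationEnergy w u) (𝓝[>] 0) :=
    (le_liminf_translationEnergy_of_contDiff hw (contDiff_mollify hloc n)).trans
      (liminf_le_liminf (Eventually.of_forall fun r => lintegral_mono fun k =>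
        mul_le_mul_right (ENNReal.div_le_div_right (translationDefect_mollify_le hu hM n _) _) _))
  calc K * gradVariation u
      ≤ K * liminf (fun n => ∫⁻ x, ‖fderiv ℝ (mollify n u) x‖ₑ) atTop :=
        mul_le_mul_right (gradVariation_le_liminf_lintegral_fderiv_mollify hu hM) K
    _ ≤ liminf (fun n => K * ∫⁻ x, ‖fderiv ℝ (mollify n u) x‖ₑ) atTop :=
        ENNReal.le_liminf_mul.trans' (by simp)
    _ ≤ liminf (translationEnergy w u) (𝓝[>] 0) :=
        (liminf_le_liminf (Eventually.of_forall hmollify)).trans_eq (liminf_const _)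

theorem tendsto_translationEnergy (hw : IsIsotropicWeight w K) (hu : Measurable u)
    (hM : ∀ x, ‖u x‖ ≤ M) :
    Tendsto (translationEnergy w u) (𝓝[>] 0) (𝓝 (K * gradVariation u)) := by
  refine tendsto_of_le_liminf_of_limsup_le (le_liminf_translationEnergy hw hu hM) ?_
  refine (limsup_le_limsup ?_).trans_eq (limsup_const (K * gradVariation u))
  filter_upwards [self_mem_nhdsWithin] with r hr using translationEnergy_le hw hu hM hr

end EnergyBounds

section PolarCoordinates

variable {E : Type*} [NormedAddCommGroup E] [NormedSpace ℝ E] [FiniteDimensional ℝ E]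
  [MeasureSpace E] [BorelSpace E] [(volume : Measure E).IsAddHaarMeasure]

theorem lintegral_eq_lintegral_sphere [Nontrivial E] {f : E → ℝ≥0∞} (hf : Measurable f) :
    ∫⁻ x, f x = ∫⁻ ω, ∫⁻ s in Ioi (0 : ℝ),
      ENNReal.ofReal (s ^ (Module.finrank ℝ E - 1)) * f (s • (ω : E))
        ∂volume ∂((volume : Measure E).toSphere) := by
  have hpolar : Measurable fun p : Metric.sphere (0 : E) 1 × Ioi (0 : ℝ) =>
      f ((p.2 : ℝ) • (p.1 : E)) := by fun_prop
  calc ∫⁻ x, f x = ∫⁻ x : ({(0)}ᶜ : Set E), f x ∂(volume.comap Subtype.val) := by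
        rw [lintegral_subtype_comap (measurableSet_singleton _).compl f, restrict_compl_singleton]
    _ = ∫⁻ p, f ((p.2 : ℝ) • (p.1 : E)) ∂(volume : Measure E).toSphere.prod
          (.volumeIoiPow (Module.finrank ℝ E - 1)) := by
        rw [← (volume : Measure E).measurePreserving_homeomorphUnitSphereProd.lintegral_comp_emb
          (Homeomorph.measurableEmbedding _)]
        refine lintegral_congr fun x => ?_
        rw [← homeomorphUnitSphereProd_symm_apply_coe, Homeomorph.symm_apply_apply]
    _ = _ := by
        rw [lintegral_prod _ hpolar.aemeasurable]
        refine lintegral_congr fun ω => ?_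
        dsimp only
        have hray : Measurable fun s : Ioi (0 : ℝ) => f ((s : ℝ) • (ω : E)) := by fun_prop
        rw [Measure.volumeIoiPow, lintegral_withDensity_eq_lintegral_mul _ (by fun_prop) hray,
          ← lintegral_subtype_comap measurableSet_Ioi]
        rfl

theorem lintegral_radial_mul_enorm [Nontrivial E] {g : ℝ → ℝ≥0∞} (hg : Measurable g)
    (L : E →L[ℝ] ℝ) :
    ∫⁻ k, g ‖k‖ * ‖L k‖ₑ =
      (∫⁻ s in Ioi (0 : ℝ), ENNReal.ofReal (s ^ Module.finrank ℝ E) * g s) *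
        ∫⁻ ω : Metric.sphere (0 : E) 1, ‖L ω‖ₑ ∂((volume : Measure E).toSphere) := by
  rw [lintegral_eq_lintegral_sphere (by fun_prop), ← lintegral_const_mul _ (by fun_prop)]
  refine lintegral_congr fun ω => ?_
  rw [← lintegral_mul_const' _ _ enorm_ne_top]
  refine setLIntegral_congr_fun measurableSet_Ioi fun s (hs : 0 < s) => ?_
  have hnorm : ‖s • (ω : E)‖ = s := by
    rw [norm_smul, norm_eq_of_mem_sphere, mul_one, Real.norm_of_nonneg hs.le]
  have hpow : s ^ Module.finrank ℝ E = s ^ (Module.finrank ℝ E - 1) * s :=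
    (pow_sub_one_mul Module.finrank_pos.ne' s).symm
  rw [hnorm, map_smul, smul_eq_mul, enorm_mul, Real.enorm_of_nonneg hs.le, hpow,
    ENNReal.ofReal_mul (by positivity)]
  ring

theorem lintegral_comp_smul_pos (f : E → ℝ≥0∞) {r : ℝ} (hr : 0 < r) :
    ENNReal.ofReal (r ^ Module.finrank ℝ E) * ∫⁻ x, f (r • x) = ∫⁻ x, f x := by
  have hmap : ∫⁻ x, f (r • x) = ∫⁻ x, f x ∂(volume.map (r • ·)) :=
    ((Homeomorph.smulOfNeZero r hr.ne').measurableEmbedding.lintegral_map f).symm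
  rw [hmap, Measure.map_addHaar_smul _ hr.ne', lintegral_smul_measure, smul_eq_mul, ← mul_assoc,
    ← ENNReal.ofReal_mul (by positivity), abs_of_pos (by positivity),
    mul_inv_cancel₀ (by positivity), ENNReal.ofReal_one, one_mul]

end PolarCoordinates

section Isotropy

variable {E : Type*} [NormedAddCommGroup E] [InnerProductSpace ℝ E] [FiniteDimensional ℝ E]
  [MeasurableSpace E] [BorelSpace E]

theorem lintegral_radial_mul_inner_eq (g : ℝ → ℝ≥0∞) {e e' : E} (h : ‖e‖ = ‖e'‖) :
    ∫⁻ k, g ‖k‖ * ‖inner ℝ e k‖ₑ = ∫⁻ k, g ‖k‖ * ‖inner ℝ e' k‖ₑ := by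
  let R := (ℝ ∙ (e - e'))ᗮ.reflection
  have hR : R e = e' := Submodule.reflection_sub h
  rw [← R.measurePreserving.lintegral_comp_emb R.toHomeomorph.measurableEmbedding
    (fun k => g ‖k‖ * ‖inner ℝ e' k‖ₑ)]
  refine lintegral_congr fun k => ?_
  rw [R.norm_map, ← hR, R.inner_map_map]

theorem isIsotropicWeight_radial {g : ℝ → ℝ≥0∞} (hg : Measurable g) {e : E} (he : ‖e‖ = 1) :
    IsIsotropicWeight (fun k : E => g ‖k‖) (∫⁻ k, g ‖k‖ * ‖inner ℝ e k‖ₑ) := by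
  refine ⟨by fun_prop, fun L => ?_⟩
  obtain ⟨ξ, rfl⟩ := (InnerProductSpace.toDual ℝ E).surjective L
  have hξ : ‖ξ‖ = ‖‖ξ‖ • e‖ := by rw [norm_smul, norm_norm, he, mul_one]
  have hscale (k : E) : g ‖k‖ * ‖inner ℝ (‖ξ‖ • e) k‖ₑ = g ‖k‖ * ‖inner ℝ e k‖ₑ * ‖ξ‖ₑ := by
    rw [real_inner_smul_left, enorm_mul, enorm_norm, mul_left_comm, mul_comm]
  simp only [InnerProductSpace.toDual_apply_apply]
  rw [lintegral_radial_mul_inner_eq g hξ, lintegral_congr hscale,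
    lintegral_mul_const _ (by fun_prop), LinearIsometryEquiv.enorm_map]

end Isotropy

section JumpKernel

/-- The radial profile of the kernel `|h| ^ (γ - N)` restricted to the increments `h` with
`t |h| ^ (1 + γ) < 1`, across which a unit jump has difference quotient larger than `t`. -/
def jumpKernel (N : ℕ) (γ t s : ℝ) : ℝ≥0∞ :=
  if t * s ^ (1 + γ) < 1 then ENNReal.ofReal (s ^ (γ - (N : ℝ))) else 0

theorem measurable_jumpKernel (N : ℕ) (γ t : ℝ) : Measurable (jumpKernel N γ t) :=
  Measurable.ite (measurableSet_lt (by fun_prop) measurable_const) (by fun_prop) measurable_const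

theorem jumpKernel_mul (N : ℕ) (γ : ℝ) {r s : ℝ} (hr : 0 < r) (hs : 0 ≤ s) :
    jumpKernel N γ (r ^ (-(1 + γ))) (r * s) =
      ENNReal.ofReal (r ^ (γ - (N : ℝ))) * jumpKernel N γ 1 s := by
  have hscale : r ^ (-(1 + γ)) * (r * s) ^ (1 + γ) = 1 * s ^ (1 + γ) := by
    rw [Real.mul_rpow hr.le hs, ← mul_assoc, ← Real.rpow_add hr, neg_add_cancel, Real.rpow_zero]
  rw [jumpKernel, jumpKernel, hscale, mul_ite, mul_zero, Real.mul_rpow hr.le hs,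
    ENNReal.ofReal_mul (by positivity)]

theorem lintegral_comp_rpow_Ioi (g : ℝ → ℝ≥0∞) {p : ℝ} (hp : p ≠ 0) :
    ∫⁻ s in Ioi (0 : ℝ), ENNReal.ofReal (|p| * s ^ (p - 1)) * g (s ^ p) =
      ∫⁻ y in Ioi (0 : ℝ), g y := by
  have hderiv (s : ℝ) (hs : s ∈ Ioi (0 : ℝ)) :
      HasDerivWithinAt (fun s : ℝ => s ^ p) (p * s ^ (p - 1)) (Ioi 0) s :=
    (Real.hasDerivAt_rpow_const (Or.inl (ne_of_gt hs))).hasDerivWithinAt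
  have hinj : InjOn (fun s : ℝ => s ^ p) (Ioi 0) :=
    fun x hx y hy hxy => (Real.rpow_left_inj (le_of_lt hx) (le_of_lt hy) hp).1 hxy
  have himage : (fun s : ℝ => s ^ p) '' Ioi 0 = Ioi 0 := by
    refine Subset.antisymm (image_subset_iff.2 fun s hs => Real.rpow_pos_of_pos hs p)
      fun y hy => ⟨y ^ p⁻¹, Real.rpow_pos_of_pos hy _, Real.rpow_inv_rpow (le_of_lt hy) hp⟩
  rw [← congrArg (fun S => ∫⁻ y in S, g y) himage,
    lintegral_image_eq_lintegral_abs_deriv_mul measurableSet_Ioi hderiv hinj]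
  refine setLIntegral_congr_fun measurableSet_Ioi fun s hs => ?_
  rw [abs_mul, abs_of_pos (Real.rpow_pos_of_pos hs _)]

theorem lintegral_pow_mul_jumpKernel (N : ℕ) {γ : ℝ} (hγ : γ ≠ -1) :
    ∫⁻ s in Ioi (0 : ℝ), ENNReal.ofReal (s ^ N) * jumpKernel N γ 1 s =
      ENNReal.ofReal |γ + 1|⁻¹ := by
  have hp : 1 + γ ≠ 0 := fun h => hγ (by linarith)
  have hpoint (s : ℝ) (hs : s ∈ Ioi (0 : ℝ)) :
      ENNReal.ofReal (s ^ N) * jumpKernel N γ 1 s = ENNReal.ofReal |γ + 1|⁻¹ *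
        (ENNReal.ofReal (|1 + γ| * s ^ (1 + γ - 1)) * (Iio 1).indicator 1 (s ^ (1 + γ))) := by
    have hs : 0 < s := hs
    have hrpow : s ^ N * s ^ (γ - N) = s ^ γ := by
      rw [← Real.rpow_natCast, ← Real.rpow_add hs, add_sub_cancel]
    rw [jumpKernel, one_mul, ← mul_assoc, ← ENNReal.ofReal_mul (by positivity), ← mul_assoc,
      add_comm γ 1, inv_mul_cancel₀ (abs_ne_zero.2 hp), one_mul, add_sub_cancel_left]
    by_cases h : s ^ (1 + γ) < 1
    · simp [h, ← ENNReal.ofReal_mul (pow_nonneg hs.le N), hrpow]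
    · simp [h]
  rw [setLIntegral_congr_fun measurableSet_Ioi hpoint,
    lintegral_const_mul' _ _ ENNReal.ofReal_ne_top, lintegral_comp_rpow_Ioi _ hp,
    setLIntegral_indicator measurableSet_Iio, Iio_inter_Ioi]
  simp

variable {N : ℕ} {e : EuclideanSpace ℝ (Fin N)}

theorem lintegral_sphere_inner (e : EuclideanSpace ℝ (Fin N)) :
    ∫⁻ ω : Metric.sphere (0 : EuclideanSpace ℝ (Fin N)) 1,
      ‖inner ℝ e (ω : EuclideanSpace ℝ (Fin N))‖ₑ
        ∂((volume : Measure (EuclideanSpace ℝ (Fin N))).toSphere) =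
      ENNReal.ofReal (kappa 1 e) := by
  have hcont : Continuous fun ω : Metric.sphere (0 : EuclideanSpace ℝ (Fin N)) 1 =>
      |inner ℝ e (ω : EuclideanSpace ℝ (Fin N))| := by fun_prop
  simp_rw [kappa, Real.rpow_one, ← ofReal_norm, Real.norm_eq_abs]
  exact (ofReal_integral_eq_lintegral_ofReal
    (hcont.integrable_of_hasCompactSupport (HasCompactSupport.of_compactSpace _))
    (Eventually.of_forall fun _ => abs_nonneg _)).symm

theorem isIsotropicWeight_jumpKernel {γ : ℝ} (hγ : γ ≠ -1) (he : ‖e‖ = 1) :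
    IsIsotropicWeight (fun k : EuclideanSpace ℝ (Fin N) => jumpKernel N γ 1 ‖k‖)
      (ENNReal.ofReal (kappa 1 e / |γ + 1|)) := by
  have : Nontrivial (EuclideanSpace ℝ (Fin N)) :=
    ⟨e, 0, fun h => by simp [h] at he⟩
  have hκ : ∫⁻ k, jumpKernel N γ 1 ‖k‖ * ‖inner ℝ e k‖ₑ =
      ENNReal.ofReal (kappa 1 e / |γ + 1|) := by
    have hpolar := lintegral_radial_mul_enorm (measurable_jumpKernel N γ 1) (innerSL ℝ e)
    simp only [innerSL_apply_apply] at hpolar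
    rw [hpolar, finrank_euclideanSpace_fin, lintegral_pow_mul_jumpKernel N hγ,
      lintegral_sphere_inner, ← ENNReal.ofReal_mul (by positivity), div_eq_inv_mul]
  exact hκ ▸ isIsotropicWeight_radial (measurable_jumpKernel N γ 1) he

end JumpKernel

section IndicatorDefect

variable {E : Type*} [AddGroup E] [MeasureSpace E] [MeasurableAdd E] {Ω : Set E}

theorem translationDefect_indicator (hΩ : MeasurableSet Ω) (h : E) :
    translationDefect (Ω.indicator fun _ => 1) h = volume {y | ¬(y + h ∈ Ω ↔ y ∈ Ω)} := by
  have hmeas : MeasurableSet {y | ¬(y + h ∈ Ω ↔ y ∈ Ω)} :=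
    ((measurable_add_const h hΩ).iff hΩ).compl
  rw [← lintegral_indicator_one hmeas]
  refine lintegral_congr fun y => ?_
  by_cases hyh : y + h ∈ Ω <;> by_cases hy : y ∈ Ω <;> simp [hyh, hy]

variable [(volume : Measure E).IsAddRightInvariant]

theorem translationDefect_indicator_le (hΩ : MeasurableSet Ω) (h : E) :
    translationDefect (Ω.indicator fun _ => 1) h ≤
      volume (Ω \ (· + h) ⁻¹' Ω) + volume (Ω \ (· + -h) ⁻¹' Ω) := by
  rw [translationDefect_indicator hΩ, ← measure_preimage_add_right volume h (Ω \ (· + -h) ⁻¹' Ω)]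
  refine (measure_mono fun y hy => ?_).trans (measure_union_le _ _)
  simp only [mem_ofPred_eq, mem_union, Set.mem_sdiff, mem_preimage, add_neg_cancel_right] at hy ⊢
  tauto

theorem translationDefect_indicator_le_two_mul (hΩ : MeasurableSet Ω) (h : E) :
    translationDefect (Ω.indicator fun _ => 1) h ≤ 2 * volume Ω := by
  rw [two_mul]
  exact (translationDefect_indicator_le hΩ h).trans
    (add_le_add (measure_mono sdiff_subset) (measure_mono sdiff_subset))

end IndicatorDefect

section SuperlevelSets

variable {N : ℕ} {Ω : Set (EuclideanSpace ℝ (Fin N))}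

theorem measurableSet_superlevelSet {u : EuclideanSpace ℝ (Fin N) → ℝ} (hu : Measurable u)
    (t γ : ℝ) : MeasurableSet (superlevelSet t γ u) := by
  have hquot : Measurable fun z : EuclideanSpace ℝ (Fin N) × EuclideanSpace ℝ (Fin N) =>
      |diffQuot γ u z.1 z.2| := by
    unfold diffQuot
    fun_prop
  exact (measurableSet_eq_fun measurable_fst measurable_snd).compl.inter
    (measurableSet_lt measurable_const hquot)

theorem nuMeasure_eq_lintegral_slices (γ : ℝ)
    {S : Set (EuclideanSpace ℝ (Fin N) × EuclideanSpace ℝ (Fin N))} (hS : MeasurableSet S)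
    (hdiag : S ⊆ {z | z.1 ≠ z.2}) :
    nuMeasure N γ S =
      ∫⁻ h, ENNReal.ofReal (‖h‖ ^ (γ - (N : ℝ))) * volume {y | (y + h, y) ∈ S} := by
  have hshift : Measurable fun p : EuclideanSpace ℝ (Fin N) × EuclideanSpace ℝ (Fin N) =>
      (p.1 + p.2, p.1) := by fun_prop
  have hslice (h : EuclideanSpace ℝ (Fin N)) : MeasurableSet {y | (y + h, y) ∈ S} :=
    (measurable_id.add_const h).prodMk measurable_id hS
  have hdens : Measurable fun z : EuclideanSpace ℝ (Fin N) × EuclideanSpace ℝ (Fin N) =>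
      ENNReal.ofReal (‖z.1 - z.2‖ ^ (γ - (N : ℝ))) := by fun_prop
  rw [nuMeasure, withDensity_apply _ hS, Measure.restrict_restrict hS, inter_eq_left.2 hdiag,
    ← lintegral_indicator hS, Measure.volume_eq_prod,
    lintegral_prod_symm _ (hdens.indicator hS).aemeasurable]
  calc ∫⁻ y, ∫⁻ x, S.indicator (fun z => ENNReal.ofReal (‖z.1 - z.2‖ ^ (γ - (N : ℝ)))) (x, y)
      = ∫⁻ y, ∫⁻ h, ENNReal.ofReal (‖h‖ ^ (γ - (N : ℝ))) * S.indicator 1 (y + h, y) := by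
        refine lintegral_congr fun y => ?_
        rw [← lintegral_add_left_eq_self _ y]
        refine lintegral_congr fun h => ?_
        by_cases hz : (y + h, y) ∈ S <;> simp [hz]
    _ = ∫⁻ h, ∫⁻ y, ENNReal.ofReal (‖h‖ ^ (γ - (N : ℝ))) * S.indicator 1 (y + h, y) := by
        have hind := (measurable_one.indicator hS).comp hshift (γ := ℝ≥0∞)
        refine lintegral_lintegral_swap (Measurable.aemeasurable ?_)
        exact Measurable.mul (by fun_prop) hind
    _ = ∫⁻ h, ENNReal.ofReal (‖h‖ ^ (γ - (N : ℝ))) * volume {y | (y + h, y) ∈ S} := by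
        refine lintegral_congr fun h => ?_
        rw [lintegral_const_mul' _ _ ENNReal.ofReal_ne_top, ← lintegral_indicator_one (hslice h)]
        rfl

theorem mem_superlevelSet_indicator_iff (Ω : Set (EuclideanSpace ℝ (Fin N))) (γ : ℝ) {t : ℝ}
    (ht : 0 ≤ t) (x y : EuclideanSpace ℝ (Fin N)) :
    (x, y) ∈ superlevelSet t γ (Ω.indicator fun _ => 1) ↔
      t * ‖x - y‖ ^ (1 + γ) < 1 ∧ ¬(x ∈ Ω ↔ y ∈ Ω) := by
  by_cases hΩ : x ∈ Ω ↔ y ∈ Ω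
  · have hflat : Ω.indicator (fun _ => (1 : ℝ)) x = Ω.indicator (fun _ => 1) y := by
      by_cases hx : x ∈ Ω <;> simp_all
    simp [superlevelSet, diffQuot, hflat, hΩ, ht]
  · have hne : x ≠ y := fun h => hΩ (h ▸ Iff.rfl)
    have hpos : 0 < ‖x - y‖ ^ (1 + γ) := Real.rpow_pos_of_pos (norm_sub_pos_iff.2 hne) _
    have hjump : |Ω.indicator (fun _ => (1 : ℝ)) x - Ω.indicator (fun _ => 1) y| = 1 := by
      by_cases hx : x ∈ Ω <;> by_cases hy : y ∈ Ω <;> simp_all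
    rw [← lt_div_iff₀ hpos]
    simp [superlevelSet, diffQuot, hΩ, hne, abs_div, hjump, abs_of_pos hpos]

theorem nuMeasure_superlevelSet (hΩ : MeasurableSet Ω) (γ : ℝ) {t : ℝ} (ht : 0 ≤ t) :
    nuMeasure N γ (superlevelSet t γ (Ω.indicator fun _ => 1)) =
      ∫⁻ h, jumpKernel N γ t ‖h‖ * translationDefect (Ω.indicator fun _ => 1) h := by
  rw [nuMeasure_eq_lintegral_slices γ
    (measurableSet_superlevelSet (measurable_const.indicator hΩ) t γ) fun z hz => hz.1]
  refine lintegral_congr fun h => ?_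
  simp_rw [mem_superlevelSet_indicator_iff Ω γ ht, translationDefect_indicator hΩ,
    add_sub_cancel_left, jumpKernel]
  split_ifs with hjump <;> simp [hjump]

theorem mul_nuMeasure_superlevelSet (hΩ : MeasurableSet Ω) (γ : ℝ) {r : ℝ} (hr : 0 < r) :
    ENNReal.ofReal (r ^ (-(1 + γ))) *
        nuMeasure N γ (superlevelSet (r ^ (-(1 + γ))) γ (Ω.indicator fun _ => 1)) =
      translationEnergy (fun k => jumpKernel N γ 1 ‖k‖) (Ω.indicator fun _ => 1) r := by
  have hpow : ENNReal.ofReal (r ^ (-(1 + γ))) * (ENNReal.ofReal (r ^ N) *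
      ENNReal.ofReal (r ^ (γ - (N : ℝ)))) = (ENNReal.ofReal r)⁻¹ := by
    rw [← ENNReal.ofReal_mul (by positivity), ← ENNReal.ofReal_mul (by positivity),
      ← ENNReal.ofReal_inv_of_pos hr, ← Real.rpow_natCast, ← Real.rpow_add hr,
      ← Real.rpow_add hr, ← Real.rpow_neg_one]
    congr 2
    ring
  rw [nuMeasure_superlevelSet hΩ γ (by positivity), ← lintegral_comp_smul_pos _ hr,
    finrank_euclideanSpace_fin, ← mul_assoc, ← lintegral_const_mul' _ _ (by finiteness),
    translationEnergy]
  refine lintegral_congr fun k => ?_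
  rw [norm_smul, Real.norm_of_nonneg hr.le, jumpKernel_mul N γ hr (norm_nonneg k),
    ENNReal.div_eq_inv_mul, ← hpow]
  ring

end SuperlevelSets

section JumpLimits

variable {N : ℕ} {Ω : Set (EuclideanSpace ℝ (Fin N))} {e : EuclideanSpace ℝ (Fin N)} {γ : ℝ}

theorem abs_indicator_one_le {α : Type*} (s : Set α) (x : α) :
    |s.indicator (fun _ => (1 : ℝ)) x| ≤ 1 := by
  by_cases hx : x ∈ s <;> simp [hx]

theorem tendsto_mul_nuMeasure_of_tendsto_rpow (hΩ : MeasurableSet Ω) (hγ : γ ≠ -1) (he : ‖e‖ = 1)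
    {l : Filter ℝ} (hpos : ∀ᶠ t in l, 0 < t)
    (hl : Tendsto (fun t : ℝ => t ^ (-(1 + γ))⁻¹) l (𝓝 0)) :
    Tendsto (fun t : ℝ => ENNReal.ofReal t *
        nuMeasure N γ (superlevelSet t γ (Ω.indicator fun _ => 1))) l
      (𝓝 (ENNReal.ofReal (kappa 1 e / |γ + 1|) * gradVariation (Ω.indicator fun _ => 1))) := by
  have hl' : Tendsto (fun t : ℝ => t ^ (-(1 + γ))⁻¹) l (𝓝[>] 0) :=
    tendsto_nhdsWithin_iff.2 ⟨hl, hpos.mono fun t ht => Real.rpow_pos_of_pos ht _⟩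
  have henergy := tendsto_translationEnergy (isIsotropicWeight_jumpKernel hγ he)
    (measurable_const.indicator hΩ) (abs_indicator_one_le Ω)
  refine (henergy.comp hl').congr' ?_
  filter_upwards [hpos] with t ht
  have hexp : -(1 + γ) ≠ 0 := fun h => hγ (by linarith)
  have hscale := mul_nuMeasure_superlevelSet hΩ γ (Real.rpow_pos_of_pos ht (-(1 + γ))⁻¹)
  rw [← Real.rpow_mul ht.le, inv_mul_cancel₀ hexp, Real.rpow_one] at hscale
  exact hscale.symm

theorem tendsto_mul_nuMeasure_atTop (hΩ : MeasurableSet Ω) (hγ : -1 < γ) (he : ‖e‖ = 1) :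
    Tendsto (fun t : ℝ => ENNReal.ofReal t *
        nuMeasure N γ (superlevelSet t γ (Ω.indicator fun _ => 1))) atTop
      (𝓝 (ENNReal.ofReal (kappa 1 e / |γ + 1|) * gradVariation (Ω.indicator fun _ => 1))) := by
  refine tendsto_mul_nuMeasure_of_tendsto_rpow hΩ hγ.ne' he (eventually_gt_atTop 0) ?_
  rw [inv_neg]
  exact tendsto_rpow_neg_atTop (inv_pos.2 (by linarith))

theorem tendsto_mul_nuMeasure_nhdsGT_zero (hΩ : MeasurableSet Ω) (hγ : γ < -1) (he : ‖e‖ = 1) :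
    Tendsto (fun t : ℝ => ENNReal.ofReal t *
        nuMeasure N γ (superlevelSet t γ (Ω.indicator fun _ => 1))) (𝓝[>] 0)
      (𝓝 (ENNReal.ofReal (kappa 1 e / |γ + 1|) * gradVariation (Ω.indicator fun _ => 1))) := by
  have hexp : 0 < (-(1 + γ))⁻¹ := inv_pos.2 (by linarith)
  refine tendsto_mul_nuMeasure_of_tendsto_rpow hΩ hγ.ne he self_mem_nhdsWithin ?_
  have hcont := (Real.continuousAt_rpow_const 0 _ (Or.inr hexp.le)).tendsto
  rw [Real.zero_rpow hexp.ne'] at hcont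
  exact hcont.mono_left nhdsWithin_le_nhds

end JumpLimits

section FractionalPerimeter

variable {N : ℕ} {Ω : Set (EuclideanSpace ℝ (Fin N))} {γ : ℝ}

/-- The fractional perimeter `∫ |h| ^ (γ - N) |Ω △ (Ω - h)| dh` of order `-γ`. -/
def fractionalPerimeter (γ : ℝ) (Ω : Set (EuclideanSpace ℝ (Fin N))) : ℝ≥0∞ :=
  ∫⁻ h, ENNReal.ofReal (‖h‖ ^ (γ - (N : ℝ))) * translationDefect (Ω.indicator fun _ => 1) h

theorem nuMeasure_superlevelSet_le_fractionalPerimeter (hΩ : MeasurableSet Ω) (γ : ℝ) {t : ℝ}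
    (ht : 0 ≤ t) :
    nuMeasure N γ (superlevelSet t γ (Ω.indicator fun _ => 1)) ≤ fractionalPerimeter γ Ω := by
  rw [nuMeasure_superlevelSet hΩ γ ht]
  refine lintegral_mono fun h => mul_le_mul_left ?_ _
  unfold jumpKernel
  split_ifs <;> simp

theorem nuMeasure_superlevelSet_neg_one (hΩ : MeasurableSet Ω) {t : ℝ} (ht : 0 ≤ t)
    (ht₁ : t < 1) :
    nuMeasure N (-1) (superlevelSet t (-1) (Ω.indicator fun _ => 1)) =
      fractionalPerimeter (-1) Ω := by
  rw [nuMeasure_superlevelSet hΩ _ ht]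
  simp [jumpKernel, ht₁, fractionalPerimeter]

theorem lintegral_tail_rpow_lt_top (hγ : γ < 0) :
    ∫⁻ h : EuclideanSpace ℝ (Fin N) in {h | 1 ≤ ‖h‖}, ENNReal.ofReal (‖h‖ ^ (γ - (N : ℝ))) <
      ⊤ := by
  have hint : Integrable fun h : EuclideanSpace ℝ (Fin N) => (1 + ‖h‖) ^ (-(N - γ)) :=
    integrable_one_add_norm (by rw [finrank_euclideanSpace_fin]; linarith)
  have hle (h : EuclideanSpace ℝ (Fin N)) (hh : 1 ≤ ‖h‖) :
      ‖h‖ ^ (γ - (N : ℝ)) ≤ 2 ^ (N - γ) * (1 + ‖h‖) ^ (-(N - γ)) := by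
    have hexp : γ - N ≤ 0 := by
      have : (0 : ℝ) ≤ N := N.cast_nonneg
      linarith
    rw [neg_sub, ← neg_sub γ, Real.rpow_neg zero_le_two, ← Real.inv_rpow zero_le_two,
      ← Real.mul_rpow (by positivity) (by positivity)]
    exact Real.rpow_le_rpow_of_nonpos (by positivity) (by linarith) hexp
  calc ∫⁻ h : EuclideanSpace ℝ (Fin N) in {h | 1 ≤ ‖h‖}, ENNReal.ofReal (‖h‖ ^ (γ - (N : ℝ)))
      ≤ ∫⁻ h : EuclideanSpace ℝ (Fin N) in {h | 1 ≤ ‖h‖},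
          ENNReal.ofReal (2 ^ (N - γ) * (1 + ‖h‖) ^ (-(N - γ))) :=
        setLIntegral_mono (by fun_prop) fun h hh => ENNReal.ofReal_le_ofReal (hle h hh)
    _ ≤ ∫⁻ h : EuclideanSpace ℝ (Fin N), ENNReal.ofReal (2 ^ (N - γ) * (1 + ‖h‖) ^ (-(N - γ))) :=
        setLIntegral_le_lintegral _ _
    _ < ⊤ := (hint.const_mul _).lintegral_lt_top

theorem fractionalPerimeter_lt_top (hΩ : MeasurableSet Ω) (hvol : volume Ω ≠ ⊤)
    (hV : gradVariation (Ω.indicator fun _ => 1) ≠ ⊤) {e : EuclideanSpace ℝ (Fin N)}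
    (he : ‖e‖ = 1) (hγ : -1 < γ) (hγ₀ : γ < 0) : fractionalPerimeter γ Ω < ⊤ := by
  set D := translationDefect (Ω.indicator fun _ => (1 : ℝ)) with hD
  have hnear : ∫⁻ h in {h : EuclideanSpace ℝ (Fin N) | 1 ≤ ‖h‖}ᶜ,
      ENNReal.ofReal (‖h‖ ^ (γ - (N : ℝ))) * D h < ⊤ := by
    have henergy := translationEnergy_le (isIsotropicWeight_jumpKernel hγ.ne' he)
      (measurable_const.indicator hΩ) (abs_indicator_one_le Ω) one_pos
    refine lt_of_le_of_lt ?_ (henergy.trans_lt (ENNReal.mul_lt_top ENNReal.ofReal_lt_top hV.lt_top))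
    refine (setLIntegral_mono' ?_ fun h hh => ?_).trans (setLIntegral_le_lintegral _ _)
    · exact (measurableSet_le measurable_const measurable_norm).compl
    · have hjump : ‖h‖ ^ (1 + γ) < 1 :=
        Real.rpow_lt_one (norm_nonneg h) (not_le.1 hh) (by linarith)
      simp [jumpKernel, hjump, hD]
  have hfar : ∫⁻ h in {h : EuclideanSpace ℝ (Fin N) | 1 ≤ ‖h‖},
      ENNReal.ofReal (‖h‖ ^ (γ - (N : ℝ))) * D h < ⊤ :=
    calc _ ≤ ∫⁻ h in {h : EuclideanSpace ℝ (Fin N) | 1 ≤ ‖h‖},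
          ENNReal.ofReal (‖h‖ ^ (γ - (N : ℝ))) * (2 * volume Ω) :=
        lintegral_mono fun h =>
          mul_le_mul_right (translationDefect_indicator_le_two_mul hΩ h) _
      _ < ⊤ := by
        rw [lintegral_mul_const' _ _ (by finiteness)]
        exact ENNReal.mul_lt_top (lintegral_tail_rpow_lt_top hγ₀) (by finiteness)
  rw [fractionalPerimeter,
    ← lintegral_add_compl _ (measurableSet_le measurable_const measurable_norm)]
  exact ENNReal.add_lt_top.2 ⟨hfar, hnear⟩

theorem tendsto_ofReal_mul_of_eventually_le {f : ℝ → ℝ≥0∞} {A : ℝ≥0∞} (hA : A ≠ ⊤)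
    (hf : ∀ᶠ t in 𝓝[>] (0 : ℝ), f t ≤ A) :
    Tendsto (fun t => ENNReal.ofReal t * f t) (𝓝[>] 0) (𝓝 0) := by
  have hofReal : Tendsto ENNReal.ofReal (𝓝[>] 0) (𝓝 0) := by
    simpa using (ENNReal.continuous_ofReal.tendsto 0).mono_left nhdsWithin_le_nhds
  have hupper : Tendsto (fun t : ℝ => ENNReal.ofReal t * A) (𝓝[>] 0) (𝓝 0) := by
    simpa using ENNReal.Tendsto.mul_const hofReal (Or.inr hA)
  exact tendsto_of_tendsto_of_tendsto_of_le_of_le' tendsto_const_nhds hupper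
    (Eventually.of_forall fun _ => zero_le) (hf.mono fun t ht => mul_le_mul_right ht _)

theorem tendsto_mul_nuMeasure_nhdsGT_zero_of_fractionalPerimeter_ne_top (hΩ : MeasurableSet Ω)
    (hP : fractionalPerimeter γ Ω ≠ ⊤) :
    Tendsto (fun t : ℝ => ENNReal.ofReal t *
      nuMeasure N γ (superlevelSet t γ (Ω.indicator fun _ => 1))) (𝓝[>] 0) (𝓝 0) :=
  tendsto_ofReal_mul_of_eventually_le hP <| eventually_mem_nhdsWithin.mono fun _ ht =>
    nuMeasure_superlevelSet_le_fractionalPerimeter hΩ γ (le_of_lt ht)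

theorem tendsto_mul_nuMeasure_neg_one_of_fractionalPerimeter_eq_top (hΩ : MeasurableSet Ω)
    (hP : fractionalPerimeter (-1) Ω = ⊤) :
    Tendsto (fun t : ℝ => ENNReal.ofReal t *
      nuMeasure N (-1) (superlevelSet t (-1) (Ω.indicator fun _ => 1))) (𝓝[>] 0) (𝓝 ⊤) := by
  refine tendsto_const_nhds.congr' ?_
  filter_upwards [Ioo_mem_nhdsGT (zero_lt_one (α := ℝ))] with t ht
  rw [nuMeasure_superlevelSet_neg_one hΩ ht.1.le ht.2, hP,
    ENNReal.mul_top (ENNReal.ofReal_pos.2 ht.1).ne']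

theorem not_tendsto_mul_nuMeasure_of_neg_one_le (hΩ : MeasurableSet Ω) (hvol : volume Ω ≠ ⊤)
    (hV : gradVariation (Ω.indicator fun _ => 1) ≠ ⊤) {e : EuclideanSpace ℝ (Fin N)}
    (he : ‖e‖ = 1) (hγ : -1 ≤ γ) (hγ₀ : γ < 0) {c : ℝ≥0∞} (hc₀ : c ≠ 0) (hc : c ≠ ⊤) :
    ¬ Tendsto (fun t : ℝ => ENNReal.ofReal t *
      nuMeasure N γ (superlevelSet t γ (Ω.indicator fun _ => 1))) (𝓝[>] 0) (𝓝 c) := by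
  intro hlim
  by_cases hP : fractionalPerimeter γ Ω = ⊤
  · obtain rfl : γ = -1 := by
      by_contra hne
      exact (fractionalPerimeter_lt_top hΩ hvol hV he (hγ.lt_of_ne' hne) hγ₀).ne hP
    exact hc (tendsto_nhds_unique hlim
      (tendsto_mul_nuMeasure_neg_one_of_fractionalPerimeter_eq_top hΩ hP))
  · exact hc₀ (tendsto_nhds_unique hlim
      (tendsto_mul_nuMeasure_nhdsGT_zero_of_fractionalPerimeter_ne_top hΩ hP))

end FractionalPerimeter

section ExitBounds

/-- Near `0`, translating by `h` moves at most `C |h|` of the mass of `Ω ∩ V` out of `Ω`, for some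
finite `C`: a one-sided, localized form of finite perimeter. -/
def HasLinearExit {E : Type*} [NormedAddCommGroup E] [MeasureSpace E] (Ω V : Set E) : Prop :=
  ∃ C : ℝ≥0∞, C ≠ ⊤ ∧ ∀ᶠ h in 𝓝 0, volume (V ∩ (Ω \ (· + h) ⁻¹' Ω)) ≤ C * ‖h‖ₑ

theorem exists_mem_nhdsSet_hasLinearExit {E : Type*} [NormedAddCommGroup E] [MeasureSpace E]
    {Ω F : Set E} (hF : IsCompact F) (hloc : ∀ p ∈ F, ∃ V ∈ 𝓝 p, HasLinearExit Ω V) :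
    ∃ V ∈ 𝓝ˢ F, HasLinearExit Ω V := by
  refine hF.induction_on (p := fun s => ∃ V ∈ 𝓝ˢ s, HasLinearExit Ω V) ?_ ?_ ?_ fun p hp => ?_
  · exact ⟨∅, by simp, 0, ENNReal.zero_ne_top, by simp⟩
  · rintro s t hst ⟨V, hV, hbound⟩
    exact ⟨V, nhdsSet_mono hst hV, hbound⟩
  · rintro s t ⟨V, hV, C, hC, hbound⟩ ⟨W, hW, C', hC', hbound'⟩
    refine ⟨V ∪ W, union_mem_nhdsSet hV hW, C + C', ENNReal.add_ne_top.2 ⟨hC, hC'⟩, ?_⟩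
    filter_upwards [hbound, hbound'] with h hh hh'
    rw [union_inter_distrib_right, add_mul]
    exact (measure_union_le _ _).trans (add_le_add hh hh')
  · obtain ⟨V, hV, hbound⟩ := hloc p hp
    exact ⟨interior V, mem_nhdsWithin_of_mem_nhds (interior_mem_nhds.2 hV), V,
      mem_nhdsSet_interior, hbound⟩

theorem exists_mem_frontier_of_isPreconnected {X : Type*} [TopologicalSpace X] {s t : Set X}
    (hs : IsPreconnected s) (ht : IsOpen t) {x y : X} (hx : x ∈ s) (hxt : x ∈ t) (hy : y ∈ s)
    (hyt : y ∉ t) : ∃ q ∈ s, q ∈ frontier t := by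
  by_contra! hno
  have := Subtype.preconnectedSpace hs
  rcases isClopen_iff.1 (isClopen_preimage_val ht (disjoint_right.2 hno)) with hempty | huniv
  · exact (eq_empty_iff_forall_notMem.1 hempty ⟨x, hx⟩) hxt
  · exact hyt (eq_univ_iff_forall.1 huniv ⟨y, hy⟩)

theorem hasLinearExit_univ {E : Type*} [NormedAddCommGroup E] [NormedSpace ℝ E]
    [ProperSpace E] [MeasureSpace E] {Ω : Set E} (hΩ : IsOpen Ω) (hb : Bornology.IsBounded Ω)
    (hloc : ∀ p ∈ frontier Ω, ∃ V ∈ 𝓝 p, HasLinearExit Ω V) : HasLinearExit Ω univ := by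
  have hcpt : IsCompact (frontier Ω) :=
    Metric.isCompact_of_isClosed_isBounded isClosed_frontier
      (hb.closure.subset frontier_subset_closure)
  obtain ⟨V, hV, C, hC, hbound⟩ := exists_mem_nhdsSet_hasLinearExit hcpt hloc
  obtain ⟨δ, hδ, hthick⟩ := (Metric.hasBasis_nhdsSet_thickening hcpt).mem_iff.1 hV
  refine ⟨C, hC, ?_⟩
  filter_upwards [hbound, Metric.ball_mem_nhds 0 hδ] with h hh hhδ
  rw [univ_inter]
  refine (measure_mono (subset_inter (fun x hx => hthick ?_) subset_rfl)).trans hh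
  obtain ⟨q, hq, hqΩ⟩ := exists_mem_frontier_of_isPreconnected
    (convex_segment x (x + h)).isPreconnected hΩ (left_mem_segment ℝ _ _) hx.1
    (right_mem_segment ℝ _ _) hx.2
  refine Metric.mem_thickening_iff.2 ⟨q, hqΩ, ?_⟩
  have hdist := (mem_segment_iff_wbtw.1 hq).dist_add_dist
  rw [dist_self_add_right] at hdist
  exact (le_of_add_le_of_nonneg_left hdist.le dist_nonneg).trans_lt (mem_ball_zero_iff.1 hhδ)

variable {E : Type*} [NormedAddCommGroup E] [NormedSpace ℝ E] [FiniteDimensional ℝ E]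
  [MeasureSpace E] [BorelSpace E] [(volume : Measure E).IsAddHaarMeasure] {p v : E} {Ω : Set E}

theorem measure_le_of_slices {S : Set E} (hS : MeasurableSet S) {δ : ℝ}
    (hSp : S ⊆ Metric.closedBall p δ) {b : ℝ≥0∞}
    (hb : ∀ x, volume {τ ∈ Icc (0 : ℝ) 1 | x - τ • v ∈ S} ≤ b) :
    volume S ≤ b * volume (Metric.closedBall p (δ + ‖v‖)) := by
  set T : Set (ℝ × E) := {z | z.2 - z.1 • v ∈ S} with hT
  have hTm : MeasurableSet T := by
    have hshear : Measurable fun z : ℝ × E => z.2 - z.1 • v := by fun_prop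
    exact hshear hS
  have hslice (x : E) : volume.restrict (Icc (0 : ℝ) 1) ((fun τ => (τ, x)) ⁻¹' T) ≤
      (Metric.closedBall p (δ + ‖v‖)).indicator (fun _ => b) x := by
    rw [Measure.restrict_apply (measurable_prodMk_right hTm), inter_comm]
    by_cases hx : x ∈ Metric.closedBall p (δ + ‖v‖)
    · rw [indicator_of_mem hx]
      exact hb x
    · refine (measure_mono_null (fun τ hτ => hx ?_) measure_empty).le.trans zero_le
      rw [mem_closedBall_iff_norm]
      have hτv : ‖τ • v‖ ≤ ‖v‖ := by
        rw [norm_smul, Real.norm_of_nonneg hτ.1.1]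
        exact mul_le_of_le_one_left (norm_nonneg v) hτ.1.2
      calc ‖x - p‖ = ‖(x - τ • v - p) + τ • v‖ := by congr 1; abel
        _ ≤ δ + ‖v‖ := norm_add_le_of_le (mem_closedBall_iff_norm.1 (hSp hτ.2)) hτv
  calc volume S = ∫⁻ τ in Icc (0 : ℝ) 1, volume (Prod.mk τ ⁻¹' T) := by
        have htranslate (τ : ℝ) : volume (Prod.mk τ ⁻¹' T) = volume S :=
          (congrArg volume (by ext; simp [hT, sub_eq_add_neg])).trans
            (measure_preimage_add_right volume (-(τ • v)) S)
        simp [htranslate]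
    _ = ∫⁻ x, volume.restrict (Icc (0 : ℝ) 1) ((fun τ => (τ, x)) ⁻¹' T) := by
        rw [← Measure.prod_apply hTm, Measure.prod_apply_symm hTm]
    _ ≤ ∫⁻ x, (Metric.closedBall p (δ + ‖v‖)).indicator (fun _ => b) x := lintegral_mono hslice
    _ = b * volume (Metric.closedBall p (δ + ‖v‖)) :=
        lintegral_indicator_const Metric.isClosed_closedBall.measurableSet b

theorem measure_inter_preimage_Icc_le {ρ : E → ℝ} {D : E →L[ℝ] ℝ} {c : NNReal} {δ : ℝ}
    (hρ : ApproximatesLinearOn ρ D (Metric.closedBall p δ) c) (hv : c * ‖v‖ + 1 ≤ D v)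
    (a b : ℝ) :
    volume (Metric.closedBall p δ ∩ ρ ⁻¹' Icc a b) ≤
      ENNReal.ofReal (b - a) * volume (Metric.closedBall p (δ + ‖v‖)) := by
  refine measure_le_of_slices (hρ.continuousOn.preimage_isClosed_of_isClosed
    Metric.isClosed_closedBall isClosed_Icc).measurableSet inter_subset_left fun x => ?_
  refine (Real.volume_le_diam _).trans (Metric.ediam_le fun τ hτ τ' hτ' => ?_)
  wlog hle : τ' ≤ τ generalizing τ τ'
  · rw [edist_comm]
    exact this τ' hτ' τ hτ (le_of_not_ge hle)
  have happrox := hρ _ hτ'.2.1 _ hτ.2.1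
  have hstep : x - τ' • v - (x - τ • v) = (τ - τ') • v := by module
  rw [hstep, map_smul, smul_eq_mul, norm_smul, Real.norm_of_nonneg (sub_nonneg.2 hle)] at happrox
  rw [edist_dist, Real.dist_eq, abs_of_nonneg (sub_nonneg.2 hle)]
  refine ENNReal.ofReal_le_ofReal ?_
  have hlower := (abs_le.1 happrox).1
  have hgrowth := mul_le_mul_of_nonneg_left hv (sub_nonneg.2 hle)
  linarith [hτ.2.2.1, hτ'.2.2.2]

theorem exists_hasLinearExit_of_hasStrictFDerivAt {ρ : E → ℝ} {D : E →L[ℝ] ℝ}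
    (hρ : HasStrictFDerivAt ρ D p) (hD : D ≠ 0) (hΩ : ∀ᶠ x in 𝓝 p, x ∈ Ω ↔ ρ x < 0) :
    ∃ V ∈ 𝓝 p, HasLinearExit Ω V := by
  obtain ⟨v, hv⟩ : ∃ v, D v = 2 := D.toLinearMap.surjective
    (fun h => hD (ContinuousLinearMap.coe_injective h)) 2
  have hv₀ : 0 < ‖v‖₊ := nnnorm_pos.2 fun h => by simp [h] at hv
  obtain ⟨s, hs, happrox⟩ := hρ.approximates_deriv_on_nhds (.inr (inv_pos.2 hv₀))
  obtain ⟨K, s', hs', hlip⟩ := hρ.exists_lipschitzOnWith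
  obtain ⟨δ, hδ, hball⟩ :=
    Metric.nhds_basis_closedBall.mem_iff.1 (inter_mem (inter_mem hs hs') hΩ)
  have hhalf : Metric.closedBall p (δ / 2) ⊆ Metric.closedBall p δ :=
    Metric.closedBall_subset_closedBall (by linarith)
  refine ⟨Metric.closedBall p (δ / 2), Metric.closedBall_mem_nhds p (half_pos hδ),
    K * volume (Metric.closedBall p (δ / 2 + ‖v‖)),
    ENNReal.mul_ne_top ENNReal.coe_ne_top measure_closedBall_lt_top.ne, ?_⟩
  filter_upwards [Metric.ball_mem_nhds 0 (half_pos hδ)] with h hh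
  have hshell : Metric.closedBall p (δ / 2) ∩ (Ω \ (· + h) ⁻¹' Ω) ⊆
      Metric.closedBall p (δ / 2) ∩ ρ ⁻¹' Icc (-(K * ‖h‖)) 0 := by
    rintro x ⟨hxp, hx, hxh⟩
    have hxhp : x + h ∈ Metric.closedBall p δ := by
      rw [mem_closedBall_iff_norm, add_sub_right_comm, ← add_halves δ]
      exact norm_add_le_of_le (mem_closedBall_iff_norm.1 hxp) (mem_ball_zero_iff.1 hh).le
    have hneg : ρ x < 0 := (hball (hhalf hxp)).2.1 hx
    have hnonneg : 0 ≤ ρ (x + h) := not_lt.1 fun hlt => hxh ((hball hxhp).2.2 hlt)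
    have hdist := hlip.dist_le_mul _ (hball hxhp).1.2 _ (hball (hhalf hxp)).1.2
    rw [dist_eq_norm, dist_eq_norm, add_sub_cancel_left] at hdist
    exact ⟨hxp, by linarith [(le_abs_self _).trans hdist], hneg.le⟩
  have hv' : ((‖v‖₊⁻¹ : NNReal) : ℝ) * ‖v‖ + 1 ≤ D v := by
    rw [NNReal.coe_inv, coe_nnnorm, inv_mul_cancel₀ (norm_pos_iff.2 (nnnorm_pos.1 hv₀)).ne', hv]
    norm_num
  have hslab := measure_inter_preimage_Icc_le
    (happrox.mono_set (hhalf.trans fun x hx => (hball hx).1.1)) hv' (-(K * ‖h‖)) 0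
  refine (measure_mono hshell).trans (hslab.trans_eq ?_)
  rw [sub_neg_eq_add, zero_add, ENNReal.ofReal_mul K.coe_nonneg, ENNReal.ofReal_coe_nnreal,
    ofReal_norm]
  ring

end ExitBounds

section SmoothDomains

variable {N : ℕ} {Ω : Set (EuclideanSpace ℝ (Fin N))}

theorem HasSmoothBoundary.exists_hasLinearExit (hΩ : HasSmoothBoundary Ω)
    {p : EuclideanSpace ℝ (Fin N)} (hp : p ∈ frontier Ω) : ∃ V ∈ 𝓝 p, HasLinearExit Ω V := by
  obtain ⟨U, ρ, hU, hpU, hρ, hD, hΩU⟩ := hΩ p hp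
  refine exists_hasLinearExit_of_hasStrictFDerivAt
    ((hρ.contDiffAt (hU.mem_nhds hpU)).hasStrictFDerivAt (by simp)) hD ?_
  filter_upwards [hU.mem_nhds hpU] with x hx
  simpa [hx] using Set.ext_iff.1 hΩU x

theorem IsBoundedSmoothDomain.memBVDot_indicator (hΩ : IsBoundedSmoothDomain Ω) :
    MemBVDot (Ω.indicator fun _ => 1) := by
  have hmeas : Measurable (Ω.indicator fun _ => (1 : ℝ)) :=
    measurable_const.indicator hΩ.isOpen.measurableSet
  obtain ⟨C, hC, hexit⟩ := hasLinearExit_univ hΩ.isOpen hΩ.isBounded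
    fun p hp => hΩ.smoothBoundary.exists_hasLinearExit hp
  simp only [univ_inter] at hexit
  have hexit' : ∀ᶠ h in 𝓝 0, volume (Ω \ (· + -h) ⁻¹' Ω) ≤ C * ‖h‖ₑ := by
    simpa using (continuous_neg.tendsto' 0 0 neg_zero).eventually hexit
  have hdefect : ∀ᶠ h in 𝓝 0,
      translationDefect (Ω.indicator fun _ => (1 : ℝ)) h ≤ (C + C) * ‖h‖ₑ := by
    filter_upwards [hexit, hexit'] with h hh hh'
    rw [add_mul]
    exact (translationDefect_indicator_le hΩ.isOpen.measurableSet h).trans (add_le_add hh hh')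
  refine ⟨locallyIntegrable_of_bounded hmeas (abs_indicator_one_le Ω), ?_⟩
  exact (gradVariation_le_of_translationDefect_le hmeas (abs_indicator_one_le Ω)
    hdefect).trans_lt (by finiteness)

end SmoothDomains

section PerimeterPos

variable {N : ℕ} {Ω : Set (EuclideanSpace ℝ (Fin N))}

theorem divergence_eq_of_eventuallyEq_smul
    {φ : EuclideanSpace ℝ (Fin N) → EuclideanSpace ℝ (Fin N)} {x : EuclideanSpace ℝ (Fin N)}
    {c : ℝ} (hφ : φ =ᶠ[𝓝 x] fun y => c • y) : divergence φ x = c * N := by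
  have hfderiv : fderiv ℝ φ x = c • ContinuousLinearMap.id ℝ _ := by
    rw [hφ.fderiv_eq, fderiv_fun_const_smul differentiableAt_fun_id, fderiv_fun_id]
  simp [divergence, hfderiv, mul_comm]

theorem exists_contDiff_divergence_eqOn (hb : Bornology.IsBounded Ω) :
    ∃ φ : EuclideanSpace ℝ (Fin N) → EuclideanSpace ℝ (Fin N),
      ContDiff ℝ 1 φ ∧ HasCompactSupport φ ∧ (∀ x, ‖φ x‖ ≤ 1) ∧
        ∃ c > 0, ∀ x ∈ Ω, divergence φ x = c * N := by
  obtain ⟨R, hR, hΩR⟩ := hb.subset_ball_lt 0 0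
  have hR' : 0 < R + 1 := by linarith
  let f : ContDiffBump (0 : EuclideanSpace ℝ (Fin N)) := ⟨R, R + 1, hR, lt_add_one R⟩
  refine ⟨fun x => ((R + 1)⁻¹ * f x) • x, (contDiff_const.mul f.contDiff).smul contDiff_id,
    f.hasCompactSupport.mul_left.smul_right, fun x => ?_, (R + 1)⁻¹, inv_pos.2 hR',
    fun x hx => divergence_eq_of_eventuallyEq_smul ?_⟩
  · rw [norm_smul, norm_mul, norm_inv, Real.norm_of_nonneg hR'.le, Real.norm_of_nonneg f.nonneg,
      mul_assoc, inv_mul_le_one₀ hR']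
    rcases lt_or_ge ‖x‖ (R + 1) with hx | hx
    · exact (mul_le_of_le_one_left (norm_nonneg x) f.le_one).trans hx.le
    · rw [f.zero_of_le_dist (by simpa [f] using hx), zero_mul]
      exact hR'.le
  · filter_upwards [Metric.isOpen_ball.mem_nhds (hΩR hx)] with y hy
    rw [f.one_of_mem_closedBall (Metric.ball_subset_closedBall hy), mul_one]

theorem gradVariation_indicator_ne_zero_of_isBounded (hN : N ≠ 0) (hΩ : MeasurableSet Ω)
    (hb : Bornology.IsBounded Ω) (hvol : volume Ω ≠ 0) :
    gradVariation (Ω.indicator fun _ => 1) ≠ 0 := by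
  obtain ⟨φ, hφ, hφc, hφ₁, c, hc, hdiv⟩ := exists_contDiff_divergence_eqOn hb
  have hint : ∫ x, Ω.indicator (fun _ => (1 : ℝ)) x * divergence φ x = volume.real Ω * (c * N) := by
    simp_rw [← indicator_mul_left, one_mul]
    rw [integral_indicator hΩ, setIntegral_congr_fun hΩ hdiv, setIntegral_const, smul_eq_mul]
  refine ne_bot_of_le_ne_bot (enorm_ne_zero.2 ?_)
    (enorm_integral_mul_divergence_le (Ω.indicator fun _ => 1) hφ hφc hφ₁)
  rw [hint]
  exact mul_ne_zero (ENNReal.toReal_ne_zero.2 ⟨hvol, hb.measure_lt_top.ne⟩)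
    (mul_ne_zero hc.ne' (Nat.cast_ne_zero.2 hN))

theorem IsBoundedSmoothDomain.gradVariation_indicator_ne_zero (hΩ : IsBoundedSmoothDomain Ω)
    (hN : N ≠ 0) : gradVariation (Ω.indicator fun _ => 1) ≠ 0 :=
  gradVariation_indicator_ne_zero_of_isBounded hN hΩ.isOpen.measurableSet hΩ.isBounded
    (hΩ.isOpen.measure_pos volume hΩ.isConnected.nonempty).ne'

end PerimeterPos

section Comparison

variable {N : ℕ} {e : EuclideanSpace ℝ (Fin N)}

theorem kappa_one_pos (he : ‖e‖ = 1) : 0 < kappa 1 e := by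
  have : Nontrivial (EuclideanSpace ℝ (Fin N)) := ⟨e, 0, fun h => by simp [h] at he⟩
  simp only [kappa, Real.rpow_one]
  refine Continuous.integral_pos_of_hasCompactSupport_nonneg_nonzero (x := ⟨e, by simpa using he⟩)
    (by fun_prop) (HasCompactSupport.of_compactSpace _) (fun _ => abs_nonneg _) ?_
  simp [he]

theorem ofReal_kappa_mul_eq_iff (he : ‖e‖ = 1) {V : ℝ≥0∞} (hV₀ : V ≠ 0) (hV : V ≠ ⊤) {γ : ℝ}
    (hγ₀ : γ ≠ 0) (hγ : γ ≠ -1) :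
    ENNReal.ofReal (kappa 1 e / |γ + 1|) * V = ENNReal.ofReal (kappa 1 e / |γ|) * V ↔
      γ = -1 / 2 := by
  have hκ := kappa_one_pos he
  have hγ' : γ + 1 ≠ 0 := fun h => hγ (eq_neg_of_add_eq_zero_left h)
  rw [ENNReal.mul_left_inj hV₀ hV, ENNReal.ofReal_eq_ofReal_iff (by positivity) (by positivity),
    div_eq_div_iff (abs_ne_zero.2 hγ') (abs_ne_zero.2 hγ₀), mul_right_inj' hκ.ne', abs_eq_abs]
  grind

variable {Ω : Set (EuclideanSpace ℝ (Fin N))} {γ : ℝ}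

theorem not_tendsto_mul_nuMeasure_atTop (hΩ : MeasurableSet Ω)
    (hV₀ : gradVariation (Ω.indicator fun _ => 1) ≠ 0)
    (hV : gradVariation (Ω.indicator fun _ => 1) ≠ ⊤) (he : ‖e‖ = 1) (hγ : 0 < γ) :
    ¬ Tendsto (fun t => ENNReal.ofReal t *
        nuMeasure N γ (superlevelSet t γ (Ω.indicator fun _ => 1))) atTop
      (𝓝 (ENNReal.ofReal (kappa 1 e / |γ|) * gradVariation (Ω.indicator fun _ => 1))) := by
  intro h
  have hlim := tendsto_mul_nuMeasure_atTop hΩ (by linarith : -1 < γ) he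
  have := (ofReal_kappa_mul_eq_iff he hV₀ hV hγ.ne' (by linarith)).1 (tendsto_nhds_unique hlim h)
  linarith

theorem not_tendsto_mul_nuMeasure_nhdsGT_zero (hΩ : MeasurableSet Ω) (hvol : volume Ω ≠ ⊤)
    (hV₀ : gradVariation (Ω.indicator fun _ => 1) ≠ 0)
    (hV : gradVariation (Ω.indicator fun _ => 1) ≠ ⊤) (he : ‖e‖ = 1) (hγ : γ < 0) :
    ¬ Tendsto (fun t => ENNReal.ofReal t *
        nuMeasure N γ (superlevelSet t γ (Ω.indicator fun _ => 1))) (𝓝[>] 0)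
      (𝓝 (ENNReal.ofReal (kappa 1 e / |γ|) * gradVariation (Ω.indicator fun _ => 1))) := by
  rcases lt_or_ge γ (-1) with hlt | hge
  · intro h
    have hlim := tendsto_mul_nuMeasure_nhdsGT_zero hΩ hlt he
    have := (ofReal_kappa_mul_eq_iff he hV₀ hV hγ.ne hlt.ne).1 (tendsto_nhds_unique hlim h)
    linarith
  · have hκ : 0 < kappa 1 e / |γ| := div_pos (kappa_one_pos he) (abs_pos.2 hγ.ne)
    exact not_tendsto_mul_nuMeasure_of_neg_one_le hΩ hvol hV he hge hγ
      (mul_ne_zero (ENNReal.ofReal_pos.2 hκ).ne' hV₀) (ENNReal.mul_ne_top ENNReal.ofReal_ne_top hV)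

theorem isBoundedSmoothDomain_ball :
    IsBoundedSmoothDomain (Metric.ball (0 : EuclideanSpace ℝ (Fin N)) 1) where
  isOpen := Metric.isOpen_ball
  isConnected := (convex_ball 0 1).isConnected ⟨0, by simp⟩
  isBounded := Metric.isBounded_ball
  smoothBoundary p hp := by
    have hp₁ : ‖p‖ = 1 := by simpa using Metric.frontier_ball_subset_sphere hp
    refine ⟨univ, fun x => ‖x‖ ^ 2 - 1, isOpen_univ, mem_univ p,
      ((contDiff_norm_sq ℝ).sub contDiff_const).contDiffOn, fun h => ?_, ?_⟩
    · rw [((hasStrictFDerivAt_norm_sq p).hasFDerivAt.sub_const 1).fderiv] at h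
      simpa [hp₁] using DFunLike.congr_fun h p
    · ext x
      simp

end Comparison

theorem proposition1p2_general (N : ℕ) :
    ((∀ γ : ℝ, 0 < γ → ∃ u : EuclideanSpace ℝ (Fin N) → ℝ, MemBVDot u ∧
        ∀ e : EuclideanSpace ℝ (Fin N), ‖e‖ = 1 →
          ¬ Tendsto (fun t : ℝ => ENNReal.ofReal t * nuMeasure N γ (superlevelSet t γ u)) atTop
            (𝓝 (ENNReal.ofReal (kappa 1 e / |γ|) * gradVariation u))) ∧
      (∀ γ : ℝ, γ < 0 → ∃ u : EuclideanSpace ℝ (Fin N) → ℝ, MemBVDot u ∧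
        ∀ e : EuclideanSpace ℝ (Fin N), ‖e‖ = 1 →
          ¬ Tendsto (fun t : ℝ => ENNReal.ofReal t * nuMeasure N γ (superlevelSet t γ u)) (𝓝[>] 0)
            (𝓝 (ENNReal.ofReal (kappa 1 e / |γ|) * gradVariation u)))) ∧
    (∀ Ω : Set (EuclideanSpace ℝ (Fin N)), MeasurableSet Ω →
      ∀ u : EuclideanSpace ℝ (Fin N) → ℝ, u = Ω.indicator (fun _ => 1) →
        ∀ e : EuclideanSpace ℝ (Fin N), ‖e‖ = 1 →
          (∀ γ : ℝ, -1 < γ →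
            Tendsto (fun t : ℝ => ENNReal.ofReal t * nuMeasure N γ (superlevelSet t γ u)) atTop
              (𝓝 (ENNReal.ofReal (kappa 1 e / |γ + 1|) * gradVariation u))) ∧
          (∀ γ : ℝ, γ < -1 →
            Tendsto (fun t : ℝ => ENNReal.ofReal t * nuMeasure N γ (superlevelSet t γ u)) (𝓝[>] 0)
              (𝓝 (ENNReal.ofReal (kappa 1 e / |γ + 1|) * gradVariation u))) ∧
          (gradVariation u ≠ 0 → gradVariation u ≠ ⊤ → ∀ γ : ℝ, γ ≠ 0 → γ ≠ -1 →
            (ENNReal.ofReal (kappa 1 e / |γ + 1|) * gradVariation u =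
                ENNReal.ofReal (kappa 1 e / |γ|) * gradVariation u ↔ γ = -1 / 2))) := by
  have hball : IsBoundedSmoothDomain (Metric.ball (0 : EuclideanSpace ℝ (Fin N)) 1) :=
    isBoundedSmoothDomain_ball
  have hBV := hball.memBVDot_indicator
  have hV₀ {e : EuclideanSpace ℝ (Fin N)} (he : ‖e‖ = 1) :=
    hball.gradVariation_indicator_ne_zero fun hN => by subst hN; simp [Subsingleton.elim e 0] at he
  refine ⟨⟨fun γ hγ => ⟨_, hBV, fun e he => ?_⟩, fun γ hγ => ⟨_, hBV, fun e he => ?_⟩⟩, ?_⟩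
  · exact not_tendsto_mul_nuMeasure_atTop measurableSet_ball (hV₀ he) hBV.2.ne he hγ
  · exact not_tendsto_mul_nuMeasure_nhdsGT_zero measurableSet_ball measure_ball_lt_top.ne
      (hV₀ he) hBV.2.ne he hγ
  · rintro Ω hΩ u rfl e he
    exact ⟨fun γ hγ => tendsto_mul_nuMeasure_atTop hΩ hγ he,
      fun γ hγ => tendsto_mul_nuMeasure_nhdsGT_zero hΩ hγ he,
      fun hV₀ hV γ hγ₀ hγ => ofReal_kappa_mul_eq_iff he hV₀ hV hγ₀ hγ⟩

end

theorem proposition1p2 (N : ℕ) (hN : 1 ≤ N) :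
    -- the limit formulas fail on the homogeneous BV space, for every `γ ≠ 0`
    ((∀ γ : ℝ, 0 < γ → ∃ u : EuclideanSpace ℝ (Fin N) → ℝ, MemBVDot u ∧
        ∀ e : EuclideanSpace ℝ (Fin N), ‖e‖ = 1 →
          ¬ Tendsto (fun t : ℝ => ENNReal.ofReal t * nuMeasure N γ (superlevelSet t γ u)) atTop
            (𝓝 (ENNReal.ofReal (kappa 1 e / |γ|) * gradVariation u))) ∧
      (∀ γ : ℝ, γ < 0 → ∃ u : EuclideanSpace ℝ (Fin N) → ℝ, MemBVDot u ∧
        ∀ e : EuclideanSpace ℝ (Fin N), ‖e‖ = 1 →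
          ¬ Tendsto (fun t : ℝ => ENNReal.ofReal t * nuMeasure N γ (superlevelSet t γ u)) (𝓝[>] 0)
            (𝓝 (ENNReal.ofReal (kappa 1 e / |γ|) * gradVariation u)))) ∧
    -- the limits for characteristic functions of bounded smooth domains
    (∀ Ω : Set (EuclideanSpace ℝ (Fin N)), IsBoundedSmoothDomain Ω →
      ∀ u : EuclideanSpace ℝ (Fin N) → ℝ, u = Ω.indicator (fun _ => 1) →
        MemBVDot u ∧
        ∀ e : EuclideanSpace ℝ (Fin N), ‖e‖ = 1 →
          (∀ γ : ℝ, -1 < γ →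
            Tendsto (fun t : ℝ => ENNReal.ofReal t * nuMeasure N γ (superlevelSet t γ u)) atTop
              (𝓝 (ENNReal.ofReal (kappa 1 e / |γ + 1|) * gradVariation u))) ∧
          (∀ γ : ℝ, γ < -1 →
            Tendsto (fun t : ℝ => ENNReal.ofReal t * nuMeasure N γ (superlevelSet t γ u)) (𝓝[>] 0)
              (𝓝 (ENNReal.ofReal (kappa 1 e / |γ + 1|) * gradVariation u))) ∧
          (∀ γ : ℝ, γ ≠ 0 → γ ≠ -1 →
            (ENNReal.ofReal (kappa 1 e / |γ + 1|) * gradVariation u =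
                ENNReal.ofReal (kappa 1 e / |γ|) * gradVariation u ↔ γ = -1 / 2))) := by
  obtain ⟨hfail, hlimits⟩ := proposition1p2_general N
  refine ⟨hfail, fun Ω hΩ u hu => ⟨hu ▸ hΩ.memBVDot_indicator, fun e he => ?_⟩⟩
  obtain ⟨hpos, hneg, hiff⟩ := hlimits Ω hΩ.isOpen.measurableSet u hu e he
  exact ⟨hpos, hneg, hiff (hu ▸ hΩ.gradVariation_indicator_ne_zero (by lia))
    (hu ▸ hΩ.memBVDot_indicator.2.ne)⟩
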